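/- Let $d\ge 0$, let $\mathfrak m=(x_1,\dots,x_d)\subset\mathbb Q[x_1,\dots,x_d]$ and $A=\mathbb Q[x_1,\dots,x_d]/\mathfrak m^2$. All tensor products are over $\mathbb Q$. For $q\ge 0$ let $d_i:A^{\otimes q+2}\to A^{\otimes q+1}$ be the maps $d_i(a_0\otimes\cdots\otimes a_{q+1})=a_0\otimes\cdots\otimes a_ia_{i+1}\otimes\cdots\otimes a_{q+1}$ for $0\le i\le q$ and $d_{q+1}(a_0\otimes\cdots\otimes a_{q+1})=a_{q+1}a_0\otimes a_1\otimes\cdots\otimes a_q$, and put $b=\sum_{i=0}^{q+1}(-1)^id_i$ and $b'=\sum_{i=0}^{q}(-1)^id_i$. On $A^{\otimes q+1}$ let $t(a_0\otimes\cdots\otimes a_q)=(-1)^q\,a_q\otimes a_0\otimes\cdots\otimes a_{q-1}$ and $N=1+t+\cdots+t^q$. The periodic cyclic bicomplex has the group $A^{\otimes q+1}$ at position $(p,q)$, for all $p\in\mathbb Z$ and $q\ge 0$; its vertical differential is $b$ in the columns with $p$ even and $-b'$ in those with $p$ odd; its horizontal differential from column $p$ to column $p-1$ is $N$ for $p$ even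 and $1-t$ for $p$ odd. The periodic cyclic homology $HP_n(A)$, $n\in\mathbb Z$, is the degree $n$ homology of its direct product total complex $\mathrm{Tot}_n=\prod_{q\ge 0}A^{\otimes q+1}$ (the factor $q$ at position $(n-q,q)$). For $w\ge 0$, the weight $w$ part of $A^{\otimes q+1}$ is the span of the tensors of monomials $m_0\otimes\cdots\otimes m_q$ of total degree $w$ in $x_1,\dots,x_d$. All the maps above preserve weight, and $HP^{(w)}_n(A)$ denotes the degree $n$ homology of the direct product total complex of the weight $w$ sub-bicomplex. Then periodic cyclic homology is concentrated in weight $0$: for all $n\in\mathbb Z$, $$HP^{(0)}_n(A)\cong\begin{cases}\mathbb Q & n\text{ even},\\ 0 & n\text{ odd},\end{cases}\qquad HP^{(w)}_n(A)=0\ \text{ for every } w>0,$$ and the inclusion of the weight $0$ subcomplex induces an isomorphism $HP^{(0)}_n(A)\to HP_n(A)$. -/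

import Mathlib

namespace CyclicHomology
noncomputable section
open scoped TensorProduct
universe u

/-- The `i`-th face of a tuple `(a₀, …, aₙ₊₁)`: for `i ≤ n` it is
`(a₀, …, aᵢ aᵢ₊₁, …, aₙ₊₁)`, and for `i = n + 1` it is `(aₙ₊₁ a₀, a₁, …, aₙ)`. -/
def faceTuple {A : Type*} [Mul A] {n : ℕ} (i : Fin (n + 2)) (a : Fin (n + 2) → A) :
    Fin (n + 1) → A := fun j =>
  if i = Fin.last (n + 1) then
    if j = 0 then a (Fin.last (n + 1)) * a 0 else a j.castSucc
  else if (j : ℕ) < i then a j.castSucc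
  else if (j : ℕ) = i then a j.castSucc * a j.succ
  else a j.succ

theorem faceTuple_update (k : Type*) {A : Type*} [CommRing k] [Ring A] [Algebra k A] {n : ℕ}
    (i : Fin (n + 2)) (a : Fin (n + 2) → A) (s : Fin (n + 2)) :
    ∃ (r : Fin (n + 1)) (L : A →ₗ[k] A), ∀ x : A,
      faceTuple i (Function.update a s x) = Function.update (faceTuple i a) r (L x) := by
  have key : ∀ (r : Fin (n + 1)) (L : A →ₗ[k] A),
      (∀ x j, faceTuple i (Function.update a s x) j =
        if j = r then L x else faceTuple i a j) → ∃ (r : Fin (n + 1)) (L : A →ₗ[k] A), ∀ x : A,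
      faceTuple i (Function.update a s x) = Function.update (faceTuple i a) r (L x) := by
    intro r L h
    refine ⟨r, L, fun x => funext fun j => ?_⟩
    rw [h, Function.update_apply]
  by_cases hi : i = Fin.last (n + 1)
  · by_cases hs : s = Fin.last (n + 1)
    · refine key 0 (LinearMap.mulRight k (a 0)) fun x j => ?_
      subst hi hs
      simp only [faceTuple, Function.update_apply, Fin.ext_iff, LinearMap.mulRight_apply]
      grind
    · by_cases hs0 : s = 0
      · refine key 0 (LinearMap.mulLeft k (a (Fin.last (n + 1)))) fun x j => ?_
        subst hi hs0
        simp only [faceTuple, Function.update_apply, Fin.ext_iff, LinearMap.mulLeft_apply]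
        grind
      · refine key ⟨s, by grind⟩ LinearMap.id fun x j => ?_
        subst hi
        simp only [faceTuple, Function.update_apply, Fin.ext_iff, LinearMap.id_apply] at *
        grind
  · have hi' : (i : ℕ) < n + 1 := by grind
    rcases lt_trichotomy (s : ℕ) i with h | h | h
    · refine key ⟨s, by omega⟩ LinearMap.id fun x j => ?_
      simp only [faceTuple, Function.update_apply, Fin.ext_iff, LinearMap.id_apply] at *
      grind
    · refine key ⟨s, by omega⟩ (LinearMap.mulRight k (a ⟨s + 1, by omega⟩)) fun x j => ?_
      simp only [faceTuple, Function.update_apply, Fin.ext_iff, LinearMap.mulRight_apply] at *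
      grind
    · by_cases h1 : (s : ℕ) = i + 1
      · refine key ⟨i, by omega⟩ (LinearMap.mulLeft k (a i)) fun x j => ?_
        simp only [faceTuple, Function.update_apply, Fin.ext_iff, LinearMap.mulLeft_apply] at *
        grind
      · refine key ⟨s - 1, by omega⟩ LinearMap.id fun x j => ?_
        simp only [faceTuple, Function.update_apply, Fin.ext_iff, LinearMap.id_apply] at *
        grind



theorem exists_nat_extension {A : Type*} {n : ℕ} (a : Fin (n + 1) → A) :
    ∃ f : ℕ → A, a = fun i : Fin (n + 1) => f (i : ℕ) :=
  ⟨fun m => if h : m < n + 1 then a ⟨m, h⟩ else a 0, funext fun i => by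
    simp only [i.isLt, dif_pos, Fin.eta]⟩

theorem faceTuple_faceTuple {A : Type*} [Semigroup A] {n : ℕ} (i : Fin (n + 2)) (j : Fin (n + 3))
    (h : (j : ℕ) ≤ i) (a : Fin (n + 3) → A) :
    faceTuple i (faceTuple j a) =
      faceTuple (j.castLT (by omega)) (faceTuple i.succ a) := by
  funext l
  obtain ⟨f, rfl⟩ := exists_nat_extension a
  obtain ⟨i, hi⟩ := i
  obtain ⟨j, hj⟩ := j
  obtain ⟨l, hl⟩ := l
  have hm : ∀ x y z : A, x * y * z = x * (y * z) := mul_assoc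
  simp only [faceTuple, Fin.ext_iff, Fin.val_last, Fin.val_succ, Fin.val_castSucc, Fin.val_zero,
    Fin.val_castLT] at *
  grind

theorem finRotate_symm_val {n : ℕ} (j : Fin (n + 1)) :
    (((finRotate (n + 1)).symm j : Fin (n + 1)) : ℕ) = if (j : ℕ) = 0 then n else j - 1 := by
  obtain ⟨i, rfl⟩ := (finRotate (n + 1)).surjective j
  rw [Equiv.symm_apply_apply, coe_finRotate]
  grind

theorem faceTuple_succ_rotate {A : Type*} [Mul A] {n : ℕ} (i : Fin (n + 1))
    (a : Fin (n + 2) → A) :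
    faceTuple i.succ (fun j => a ((finRotate (n + 2)).symm j)) =
      fun j => faceTuple i.castSucc a ((finRotate (n + 1)).symm j) := by
  funext l
  obtain ⟨f, rfl⟩ := exists_nat_extension a
  simp only [faceTuple, Fin.ext_iff, finRotate_symm_val, Fin.val_last, Fin.val_succ,
    Fin.val_castSucc, Fin.val_zero]
  obtain ⟨i, hi⟩ := i
  obtain ⟨l, hl⟩ := l
  grind

theorem faceTuple_zero_rotate {A : Type*} [Mul A] {n : ℕ}
    (a : Fin (n + 2) → A) :
    faceTuple 0 (fun j => a ((finRotate (n + 2)).symm j)) = faceTuple (Fin.last (n + 1)) a := by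
  funext l
  obtain ⟨f, rfl⟩ := exists_nat_extension a
  simp only [faceTuple, Fin.ext_iff, finRotate_symm_val, Fin.val_last, Fin.val_succ,
    Fin.val_castSucc, Fin.val_zero]
  obtain ⟨l, hl⟩ := l
  grind

/-- The `(n + 1)`-fold tensor power of `A` over `k`. -/
abbrev Tens (k A : Type*) [CommRing k] [Ring A] [Algebra k A] (n : ℕ) : Type _ :=
  ⨂[k] _ : Fin (n + 1), A

section Operators

variable (k A : Type*) [CommRing k] [Ring A] [Algebra k A]

def faceMultilinear (n : ℕ) (i : Fin (n + 2)) :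
    MultilinearMap k (fun _ : Fin (n + 2) => A) (Tens k A n) where
  toFun a := PiTensorProduct.tprod k (faceTuple i a)
  map_update_add' := by
    intro inst a s x y
    obtain rfl : inst = instDecidableEqFin _ := Subsingleton.elim _ _
    obtain ⟨r, L, h⟩ := faceTuple_update k i a s
    simp only [h, map_add, MultilinearMap.map_update_add]
  map_update_smul' := by
    intro inst a s c x
    obtain rfl : inst = instDecidableEqFin _ := Subsingleton.elim _ _
    obtain ⟨r, L, h⟩ := faceTuple_update k i a s
    simp only [h, map_smul, MultilinearMap.map_update_smul]

/-- The face map `dᵢ` on tensor powers, see `face_tprod`. -/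
def face (n : ℕ) (i : Fin (n + 2)) : Tens k A (n + 1) →ₗ[k] Tens k A n :=
  PiTensorProduct.lift (faceMultilinear k A n i)

theorem face_tprod (n : ℕ) (i : Fin (n + 2)) (a : Fin (n + 2) → A) :
    face k A n i (PiTensorProduct.tprod k a) = PiTensorProduct.tprod k (faceTuple i a) := by
  simp [face, faceMultilinear]

/-- The Hochschild boundary `b = ∑ (-1)ⁱ dᵢ`, `0 ≤ i ≤ n + 1`. -/
def hochDiff (n : ℕ) : Tens k A (n + 1) →ₗ[k] Tens k A n :=
  ∑ i : Fin (n + 2), (-1 : k) ^ (i : ℕ) • face k A n i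

/-- The boundary of the bar complex: the last face map is omitted. -/
def barDiff (n : ℕ) : Tens k A (n + 1) →ₗ[k] Tens k A n :=
  ∑ i : Fin (n + 1), (-1 : k) ^ (i : ℕ) • face k A n i.castSucc

/-- The signed cyclic operator `t : a₀ ⊗ ⋯ ⊗ aₙ ↦ (-1)ⁿ aₙ ⊗ a₀ ⊗ ⋯ ⊗ aₙ₋₁`,
see `cyclicOp_tprod`. -/
def cyclicOp (n : ℕ) : Module.End k (Tens k A n) :=
  (-1 : k) ^ n • (PiTensorProduct.reindex k (fun _ => A) (finRotate (n + 1))).toLinearMap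

theorem cyclicOp_tprod (n : ℕ) (a : Fin (n + 1) → A) :
    cyclicOp k A n (PiTensorProduct.tprod k a) = (-1 : k) ^ n •
      PiTensorProduct.tprod k (Fin.cons (a (Fin.last n)) fun j : Fin n => a j.castSucc :
        Fin (n + 1) → A) := by
  simp only [cyclicOp, LinearMap.smul_apply, LinearEquiv.coe_coe, PiTensorProduct.reindex_tprod]
  congr 2
  funext j
  refine Fin.cases ?_ (fun j => ?_) j
  · rw [Fin.cons_zero]
    congr 1
  · rw [Fin.cons_succ]
    congr 1
    apply Fin.ext
    rw [finRotate_symm_val]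
    simp

/-- The norm operator `N = 1 + t + ⋯ + tⁿ`. -/
def normOp (n : ℕ) : Module.End k (Tens k A n) :=
  ∑ i ∈ Finset.range (n + 1), cyclicOp k A n ^ i

theorem face_comp_face (n : ℕ) (i : Fin (n + 2)) (j : Fin (n + 3)) (h : (j : ℕ) ≤ i) :
    face k A n i ∘ₗ face k A (n + 1) j =
      face k A n (j.castLT (by omega)) ∘ₗ face k A (n + 1) i.succ := by
  refine PiTensorProduct.ext (MultilinearMap.ext fun a => ?_)
  simp only [LinearMap.compMultilinearMap_apply, LinearMap.comp_apply, face_tprod,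
    faceTuple_faceTuple i j h]

theorem cyclicOp_pow (n : ℕ) : cyclicOp k A n ^ (n + 1) = 1 := by
  have h : ∀ (e : Equiv.Perm (Fin (n + 1))) (m : ℕ) (a : Fin (n + 1) → A),
      (((PiTensorProduct.reindex k (fun _ => A) e).toLinearMap : Module.End k (Tens k A n)) ^ m)
        (PiTensorProduct.tprod k a) = PiTensorProduct.tprod k (fun j => a ((e ^ m).symm j)) := by
    intro e m
    induction m with
    | zero => intro a; simp; rfl
    | succ m ih =>
      intro a
      rw [pow_succ, Module.End.mul_apply, LinearEquiv.coe_coe, PiTensorProduct.reindex_tprod, ih]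
      rw [pow_succ]
      rfl
  have hc : finRotate (n + 1) ^ (n + 1) = 1 := by
    rcases n with _ | n
    · exact Equiv.ext fun x => Subsingleton.elim (α := Fin 1) _ _
    · have := pow_orderOf_eq_one (finRotate (n + 2))
      rwa [(isCycle_finRotate (n := n)).orderOf, support_finRotate, Finset.card_univ,
        Fintype.card_fin] at this
  refine PiTensorProduct.ext (MultilinearMap.ext fun a => ?_)
  rw [cyclicOp, smul_pow, ← pow_mul, Even.neg_one_pow (Nat.even_mul_succ_self n), one_smul]
  simp only [LinearMap.compMultilinearMap_apply, h, hc]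
  rfl

theorem face_succ_comp_cyclicOp (n : ℕ) (i : Fin (n + 1)) :
    face k A n i.succ ∘ₗ cyclicOp k A (n + 1) = -(cyclicOp k A n ∘ₗ face k A n i.castSucc) := by
  refine PiTensorProduct.ext (MultilinearMap.ext fun a => ?_)
  simp only [LinearMap.compMultilinearMap_apply, LinearMap.comp_apply, cyclicOp, LinearMap.smul_apply,
    LinearEquiv.coe_coe, PiTensorProduct.reindex_tprod, map_smul, face_tprod, LinearMap.neg_apply,
    faceTuple_succ_rotate]
  rw [pow_succ]
  simp

theorem face_zero_comp_cyclicOp (n : ℕ) :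
    face k A n 0 ∘ₗ cyclicOp k A (n + 1) = (-1 : k) ^ (n + 1) • face k A n (Fin.last (n + 1)) := by
  refine PiTensorProduct.ext (MultilinearMap.ext fun a => ?_)
  simp only [LinearMap.compMultilinearMap_apply, LinearMap.comp_apply, cyclicOp, LinearMap.smul_apply,
    LinearEquiv.coe_coe, PiTensorProduct.reindex_tprod, map_smul, face_tprod,
    faceTuple_zero_rotate]

theorem hochDiff_eq (n : ℕ) : hochDiff k A n = barDiff k A n + face k A n 0 ∘ₗ cyclicOp k A (n + 1) := by
  rw [hochDiff, Fin.sum_univ_castSucc, face_zero_comp_cyclicOp, barDiff]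
  rfl

/-- Cancellation for alternating sums of operators that satisfy the simplicial identities. -/
theorem alternating_sum_comp_eq_zero {R M₁ M₂ M₃ : Type*} [CommRing R] [AddCommGroup M₁]
    [AddCommGroup M₂] [AddCommGroup M₃] [Module R M₁] [Module R M₂] [Module R M₃] (m : ℕ)
    (f : Fin (m + 1) → M₁ →ₗ[R] M₂) (g : Fin m → M₂ →ₗ[R] M₃)
    (h : ∀ (i : Fin m) (j : Fin (m + 1)) (_ : (j : ℕ) ≤ i),
      g i ∘ₗ f j = g (j.castLT (by omega)) ∘ₗ f i.succ) :
    (∑ i : Fin m, (-1 : R) ^ (i : ℕ) • g i) ∘ₗ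
      (∑ j : Fin (m + 1), (-1 : R) ^ (j : ℕ) • f j) = 0 := by
  have e : (∑ i : Fin m, (-1 : R) ^ (i : ℕ) • g i) ∘ₗ
      (∑ j : Fin (m + 1), (-1 : R) ^ (j : ℕ) • f j) =
      ∑ p : Fin m × Fin (m + 1), (-1 : R) ^ ((p.1 : ℕ) + p.2) • (g p.1 ∘ₗ f p.2) := by
    rw [Fintype.sum_prod_type]
    ext x
    simp [LinearMap.sum_apply, map_sum, pow_add, mul_smul, Finset.smul_sum]
  rw [e, ← Finset.sum_filter_add_sum_filter_not _ (fun p : Fin m × Fin (m + 1) =>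
    (p.2 : ℕ) ≤ p.1), ← eq_neg_iff_add_eq_zero, ← Finset.sum_neg_distrib]
  refine Finset.sum_bij' (fun p hp => (p.2.castLT (by simp at hp; omega), p.1.succ))
    (fun p hp => (p.2.pred (by rintro h; simp [h] at hp), p.1.castSucc)) ?_ ?_ ?_ ?_ ?_
  · intro p hp
    simp at hp ⊢
    omega
  · intro p hp
    simp at hp ⊢
    omega
  · intro p hp
    simp
  · intro p hp
    simp
  · intro p hp
    simp at hp
    rw [h _ _ hp, ← neg_smul]
    congr 1
    simp only [Fin.val_castLT, Fin.val_succ]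
    ring

theorem hochDiff_comp_hochDiff (n : ℕ) : hochDiff k A n ∘ₗ hochDiff k A (n + 1) = 0 :=
  alternating_sum_comp_eq_zero (n + 2) _ _ fun i j h => face_comp_face k A n i j h

theorem barDiff_comp_barDiff (n : ℕ) : barDiff k A n ∘ₗ barDiff k A (n + 1) = 0 :=
  alternating_sum_comp_eq_zero (n + 1) (fun i : Fin (n + 2) => face k A (n + 1) i.castSucc)
    (fun i : Fin (n + 1) => face k A n i.castSucc) fun i j h =>
    face_comp_face k A n i.castSucc j.castSucc h

theorem cyclicOp_comp_normOp (n : ℕ) : cyclicOp k A n ∘ₗ normOp k A n = normOp k A n := by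
  have h : (cyclicOp k A n - 1) * normOp k A n = 0 := by
    rw [normOp, mul_geom_sum, cyclicOp_pow, sub_self]
  rw [sub_mul, one_mul, sub_eq_zero] at h
  exact h

theorem normOp_comp_cyclicOp (n : ℕ) : normOp k A n ∘ₗ cyclicOp k A n = normOp k A n := by
  have h : normOp k A n * (cyclicOp k A n - 1) = 0 := by
    rw [normOp, geom_sum_mul, cyclicOp_pow, sub_self]
  rw [mul_sub, mul_one, sub_eq_zero] at h
  exact h

/-- Moving the cyclic operator through the `i`-th face. -/
theorem face_comp_cyclicOp_pow (n : ℕ) (i : ℕ) (hi : i < n + 2) :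
    ((-1 : k) ^ i • face k A n ⟨i, hi⟩) ∘ₗ (cyclicOp k A (n + 1)) ^ i =
      ((cyclicOp k A n) ^ i : Module.End k _) ∘ₗ face k A n 0 := by
  induction i with
  | zero => simp; rfl
  | succ i ih =>
    have h1 := face_succ_comp_cyclicOp k A n ⟨i, by omega⟩
    have h2 := ih (by omega)
    simp only [Fin.succ_mk, Fin.castSucc_mk] at h1
    rw [pow_succ' (cyclicOp k A (n + 1)), Module.End.mul_eq_comp, ← LinearMap.comp_assoc,
      LinearMap.smul_comp, h1, pow_succ' (cyclicOp k A n), Module.End.mul_eq_comp, LinearMap.comp_assoc,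
      ← h2]
    ext x
    simp [pow_succ]

theorem sum_comp_right {R M₁ M₂ M₃ ι : Type*} [CommRing R] [AddCommGroup M₁] [AddCommGroup M₂]
    [AddCommGroup M₃] [Module R M₁] [Module R M₂] [Module R M₃] (s : Finset ι)
    (g : ι → M₂ →ₗ[R] M₃) (f : M₁ →ₗ[R] M₂) : (∑ i ∈ s, g i) ∘ₗ f = ∑ i ∈ s, g i ∘ₗ f := by
  ext x
  simp [LinearMap.sum_apply]

theorem comp_sum_left {R M₁ M₂ M₃ ι : Type*} [CommRing R] [AddCommGroup M₁] [AddCommGroup M₂]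
    [AddCommGroup M₃] [Module R M₁] [Module R M₂] [Module R M₃] (s : Finset ι)
    (g : M₂ →ₗ[R] M₃) (f : ι → M₁ →ₗ[R] M₂) : g ∘ₗ (∑ i ∈ s, f i) = ∑ i ∈ s, g ∘ₗ f i := by
  ext x
  simp [LinearMap.sum_apply]

theorem hochDiff_comp_one_sub_cyclicOp (n : ℕ) :
    hochDiff k A n ∘ₗ (1 - cyclicOp k A (n + 1)) = (1 - cyclicOp k A n) ∘ₗ barDiff k A n := by
  have h : barDiff k A n ∘ₗ cyclicOp k A (n + 1) + (face k A n 0 ∘ₗ cyclicOp k A (n + 1)) ∘ₗ cyclicOp k A (n + 1) =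
      face k A n 0 ∘ₗ cyclicOp k A (n + 1) + cyclicOp k A n ∘ₗ barDiff k A n := by
    have hb : hochDiff k A n = face k A n 0 +
        ∑ i : Fin (n + 1), (-1 : k) ^ ((i : ℕ) + 1) • face k A n i.succ := by
      rw [hochDiff, Fin.sum_univ_succ]
      simp
    have hs : (∑ i : Fin (n + 1), (-1 : k) ^ ((i : ℕ) + 1) • face k A n i.succ) ∘ₗ
        cyclicOp k A (n + 1) = cyclicOp k A n ∘ₗ barDiff k A n := by
      rw [barDiff, sum_comp_right, comp_sum_left]
      refine Finset.sum_congr rfl fun i _ => ?_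
      rw [LinearMap.smul_comp, face_succ_comp_cyclicOp, LinearMap.comp_smul, pow_succ]
      ext x
      simp
    rw [← LinearMap.add_comp, ← hochDiff_eq, hb, LinearMap.add_comp, hs]
  rw [LinearMap.comp_sub, LinearMap.sub_comp, hochDiff_eq, LinearMap.add_comp,
    LinearMap.add_comp, h]
  simp only [Module.End.one_eq_id, LinearMap.comp_id, LinearMap.id_comp]
  abel

theorem barDiff_comp_normOp (n : ℕ) : barDiff k A n ∘ₗ normOp k A (n + 1) = normOp k A n ∘ₗ hochDiff k A n := by
  have tN : ∀ (m i : ℕ), (cyclicOp k A m ^ i : Module.End k _) ∘ₗ normOp k A m = normOp k A m := by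
    intro m i
    induction i with
    | zero => rfl
    | succ i ih => rw [pow_succ, Module.End.mul_eq_comp, LinearMap.comp_assoc, cyclicOp_comp_normOp, ih]
  have Nt : ∀ (m i : ℕ), normOp k A m ∘ₗ (cyclicOp k A m ^ i : Module.End k _) = normOp k A m := by
    intro m i
    induction i with
    | zero => rfl
    | succ i ih => rw [pow_succ', Module.End.mul_eq_comp, ← LinearMap.comp_assoc, normOp_comp_cyclicOp, ih]
  have l : barDiff k A n ∘ₗ normOp k A (n + 1) = normOp k A n ∘ₗ face k A n 0 ∘ₗ normOp k A (n + 1) := by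
    rw [barDiff, sum_comp_right]
    conv_rhs => rw [normOp, sum_comp_right, Finset.sum_range]
    refine Finset.sum_congr rfl fun i _ => ?_
    rw [← tN (n + 1) i, ← LinearMap.comp_assoc]
    have := face_comp_cyclicOp_pow k A n i (by omega)
    have e : (⟨i, by omega⟩ : Fin (n + 2)) = i.castSucc := rfl
    rw [e] at this
    rw [this, LinearMap.comp_assoc, tN]
  have r : normOp k A n ∘ₗ hochDiff k A n = normOp k A n ∘ₗ face k A n 0 ∘ₗ normOp k A (n + 1) := by
    rw [hochDiff, comp_sum_left]
    conv_rhs => rw [← normOp_comp_cyclicOp k A (n + 1), normOp.eq_1 k A (n + 1), ← Finset.sum_range_reflect, sum_comp_right,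
      comp_sum_left, comp_sum_left, Finset.sum_range]
    refine Finset.sum_congr rfl fun i _ => ?_
    have h1 := face_comp_cyclicOp_pow k A n i i.isLt
    have h2 : cyclicOp k A (n + 1) ^ (i : ℕ) * cyclicOp k A (n + 1) ^ (n + 1 + 1 - 1 - i + 1) = 1 := by
      rw [← pow_add, ← cyclicOp_pow k A (n + 1)]
      congr 1
      omega
    calc normOp k A n ∘ₗ ((-1 : k) ^ (i : ℕ) • face k A n i)
        = normOp k A n ∘ₗ ((-1 : k) ^ (i : ℕ) • face k A n i) ∘ₗ
            (cyclicOp k A (n + 1) ^ (i : ℕ) * cyclicOp k A (n + 1) ^ (n + 1 + 1 - 1 - i + 1)) := by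
          rw [h2]; rfl
      _ = normOp k A n ∘ₗ (cyclicOp k A n ^ (i : ℕ) : Module.End k _) ∘ₗ face k A n 0 ∘ₗ
            (cyclicOp k A (n + 1) ^ (n + 1 + 1 - 1 - i + 1) : Module.End k _) := by
          rw [Module.End.mul_eq_comp, ← LinearMap.comp_assoc _ _ (_ • _), h1, LinearMap.comp_assoc]
      _ = _ := by
          rw [← LinearMap.comp_assoc, Nt, pow_succ, Module.End.mul_eq_comp]
  rw [l, r]

/-- Vertical differential of the periodic bicomplex, from position `(p, n + 1)` to `(p, n)`: the
Hochschild boundary in even columns, the bar boundary (with the usual sign that makes the squares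
anticommute) in odd columns. -/
def vert (p : ℤ) (n : ℕ) : Tens k A (n + 1) →ₗ[k] Tens k A n :=
  if Even p then hochDiff k A n else -barDiff k A n

/-- Horizontal differential of the periodic bicomplex, from position `(p, n)` to `(p - 1, n)`. -/
def horiz (p : ℤ) (n : ℕ) : Tens k A n →ₗ[k] Tens k A n :=
  if Even p then normOp k A n else 1 - cyclicOp k A n

theorem vert_comp_vert (p : ℤ) (n : ℕ) : vert k A p n ∘ₗ vert k A p (n + 1) = 0 := by
  unfold vert
  split_ifs
  · exact hochDiff_comp_hochDiff k A n
  · rw [LinearMap.neg_comp, LinearMap.comp_neg, neg_neg, barDiff_comp_barDiff]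

theorem horiz_comp_horiz (p : ℤ) (n : ℕ) : horiz k A p n ∘ₗ horiz k A (p + 1) n = 0 := by
  unfold horiz
  by_cases hp : Even p
  · rw [if_pos hp, if_neg (by simpa [Int.even_add_one] using hp), LinearMap.comp_sub, normOp_comp_cyclicOp]
    exact sub_self _
  · rw [if_neg hp, if_pos (by simpa [Int.even_add_one] using hp), LinearMap.sub_comp, cyclicOp_comp_normOp]
    exact sub_self _

theorem vert_horiz (p : ℤ) (n : ℕ) :
    vert k A p n ∘ₗ horiz k A (p + 1) (n + 1) + horiz k A (p + 1) n ∘ₗ vert k A (p + 1) n = 0 := by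
  unfold horiz vert
  by_cases hp : Even p
  · have hp' : ¬ Even (p + 1) := by simpa [Int.even_add_one] using hp
    rw [if_pos hp, if_neg hp', if_neg hp', if_neg hp', hochDiff_comp_one_sub_cyclicOp, LinearMap.comp_neg,
      add_neg_cancel]
  · have hp' : Even (p + 1) := by simpa [Int.even_add_one] using hp
    rw [if_neg hp, if_pos hp', if_pos hp', if_pos hp', LinearMap.neg_comp, barDiff_comp_normOp,
      neg_add_cancel]

/-- In every total degree `n ∈ ℤ` the total complex is the direct product over `q ≥ 0` of the terms
at position `(n - q, q)` of the periodic bicomplex; the term at `(p, q)` is `A^{⊗ (q + 1)}`. -/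
abbrev Total : Type _ := ∀ q : ℕ, Tens k A q

/-- The total differential from degree `n + 1` to degree `n`. -/
def totalD (n : ℤ) : Total k A →ₗ[k] Total k A :=
  LinearMap.pi fun q =>
    vert k A (n - q) q ∘ₗ LinearMap.proj (q + 1) + horiz k A (n - q + 1) q ∘ₗ LinearMap.proj q

theorem totalD_apply (n : ℤ) (x : Total k A) (q : ℕ) :
    totalD k A n x q = vert k A (n - q) q (x (q + 1)) + horiz k A (n - q + 1) q (x q) := rfl

theorem totalD_comp_totalD (n : ℤ) : totalD k A n ∘ₗ totalD k A (n + 1) = 0 := by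
  refine LinearMap.ext fun x => funext fun q => ?_
  have h1 := LinearMap.congr_fun (vert_comp_vert k A (n - q) q) (x (q + 2))
  have h2 := LinearMap.congr_fun (horiz_comp_horiz k A (n - q + 1) q) (x q)
  have h3 := LinearMap.congr_fun (vert_horiz k A (n - q) q) (x (q + 1))
  have e1 : n + 1 - ((q + 1 : ℕ) : ℤ) = n - q := by push_cast; ring
  have e2 : n + 1 - (q : ℤ) = n - q + 1 := by ring
  simp only [LinearMap.comp_apply, LinearMap.add_apply, LinearMap.zero_apply] at h1 h2 h3
  simp only [LinearMap.comp_apply, totalD_apply, map_add, e1, e2, LinearMap.zero_apply,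
    Pi.zero_apply, h1, h2, zero_add, add_zero]
  exact h3

end Operators

section Periodic

open CategoryTheory

variable (k A : Type u) [CommRing k] [Ring A] [Algebra k A]

/-- The (direct product) total complex of the periodic cyclic bicomplex of `A`. -/
def periodicComplex : ChainComplex (ModuleCat.{u} k) ℤ :=
  ChainComplex.of (fun _ => ModuleCat.of k (Total k A)) (fun n => ModuleCat.ofHom (totalD k A n))
    fun n => by
      rw [← ModuleCat.ofHom_comp, totalD_comp_totalD]
      rfl

/-- Periodic cyclic homology `HPₙ(A)`. -/
abbrev HP (n : ℤ) : ModuleCat.{u} k := (periodicComplex k A).homology n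

/-- A family of submodules of the tensor powers stable under the Hochschild boundary, the bar
boundary and `t` (hence also under `1 - t` and `N`). -/
structure IsStable {k A : Type u} [CommRing k] [Ring A] [Algebra k A]
    (W : ∀ n : ℕ, Submodule k (Tens k A n)) : Prop where
  hochDiff_mem : ∀ n, ∀ x ∈ W (n + 1), hochDiff k A n x ∈ W n
  barDiff_mem : ∀ n, ∀ x ∈ W (n + 1), barDiff k A n x ∈ W n
  cyclicOp_mem : ∀ n, ∀ x ∈ W n, cyclicOp k A n x ∈ W n

variable {k A}

theorem IsStable.totalD_mem {W : ∀ n : ℕ, Submodule k (Tens k A n)} (hW : IsStable W) (n : ℤ) :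
    ∀ x ∈ Submodule.pi Set.univ W, totalD k A n x ∈ Submodule.pi Set.univ W := by
  intro x hx q _
  have hx' : ∀ q, x q ∈ W q := fun q => hx q trivial
  have hN : ∀ y ∈ W q, normOp k A q y ∈ W q := by
    intro y hy
    rw [normOp, LinearMap.sum_apply]
    refine Submodule.sum_mem _ fun i hi => ?_
    clear hi
    induction i with
    | zero => simpa using hy
    | succ i ih =>
      rw [pow_succ', Module.End.mul_apply]
      exact hW.cyclicOp_mem q _ ih
  rw [totalD_apply]
  refine add_mem ?_ ?_
  · unfold vert
    split_ifs
    · exact hW.hochDiff_mem q _ (hx' _)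
    · exact neg_mem (hW.barDiff_mem q _ (hx' _))
  · unfold horiz
    split_ifs
    · exact hN _ (hx' _)
    · exact sub_mem (hx' _) (hW.cyclicOp_mem q _ (hx' _))

/-- The total complex of the sub-bicomplex given by a stable family. -/
def periodicSubcomplex (W : ∀ n : ℕ, Submodule k (Tens k A n)) (hW : IsStable W) :
    ChainComplex (ModuleCat.{u} k) ℤ :=
  ChainComplex.of (fun _ => ModuleCat.of k (Submodule.pi Set.univ W : Submodule k (Total k A)))
    (fun n => ModuleCat.ofHom ((totalD k A n).restrict (hW.totalD_mem n)))
    fun n => by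
      rw [← ModuleCat.ofHom_comp]
      refine ModuleCat.hom_ext (LinearMap.ext fun x => Subtype.ext ?_)
      exact LinearMap.congr_fun (totalD_comp_totalD k A n) x.1

/-- Its inclusion into the whole periodic complex. -/
def periodicSubcomplexInclusion (W : ∀ n : ℕ, Submodule k (Tens k A n)) (hW : IsStable W) :
    periodicSubcomplex W hW ⟶ periodicComplex k A :=
  ChainComplex.ofHom
    (fun _ => ModuleCat.ofHom (Submodule.pi Set.univ W : Submodule k (Total k A)).subtype)
    fun n => by
      simp only [periodicSubcomplex, periodicComplex, ChainComplex.of_d]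
      rfl

end Periodic

section Truncated

variable (k : Type u) [CommRing k] (d : ℕ)

/-- The ring `k[x₁, …, x_d] / (x₁, …, x_d)²`. -/
abbrev TruncPoly : Type u :=
  MvPolynomial (Fin d) k ⧸
    (Ideal.span (Set.range (MvPolynomial.X : Fin d → MvPolynomial (Fin d) k)) ^ 2)

/-- The class of the monomial with exponent `e`; it is zero as soon as `e` has degree at least 2. -/
def mono (e : Fin d →₀ ℕ) : TruncPoly k d := Ideal.Quotient.mk _ (MvPolynomial.monomial e 1)

theorem mono_add (e e' : Fin d →₀ ℕ) : mono k d (e + e') = mono k d e * mono k d e' := by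
  rw [mono, mono, mono, ← map_mul, MvPolynomial.monomial_mul, one_mul]

/-- The weight `w` part of `A^{⊗ (n + 1)}`: the span of the tensor monomials in which the total
number of variables is `w`. -/
def weightPart (w n : ℕ) : Submodule k (Tens k (TruncPoly k d) n) :=
  Submodule.span k {x | ∃ e : Fin (n + 1) → (Fin d →₀ ℕ),
    ∑ j, (e j).degree = w ∧ x = PiTensorProduct.tprod k fun j => mono k d (e j)}

theorem prod_faceTuple {M : Type*} [CommMonoid M] {n : ℕ} (i : Fin (n + 2)) (a : Fin (n + 2) → M) :
    ∏ j, faceTuple i a j = ∏ j, a j := by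
  by_cases hi : i = Fin.last (n + 1)
  · subst hi
    rw [Fin.prod_univ_castSucc a, Fin.prod_univ_succ, Fin.prod_univ_succ fun j : Fin (n + 1) => a j.castSucc]
    simp [faceTuple, Fin.succ_ne_zero, mul_comm, mul_assoc]
  · obtain ⟨i, rfl⟩ := Fin.exists_castSucc_eq.mpr hi
    rw [Fin.prod_univ_succAbove a i.succ]
    have : ∀ j, faceTuple i.castSucc a j = (if j = i then a i.succ else 1) * a (i.succ.succAbove j) := by
      intro j
      rcases lt_trichotomy j i with h | rfl | h
      · rw [Fin.succAbove_of_castSucc_lt _ _ (Fin.lt_def.mpr (by have := Fin.lt_def.mp h; simp; omega))]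
        simp [faceTuple, hi, h.ne, h]
      · simp [faceTuple, mul_comm, Fin.castSucc_ne_last]
      · rw [Fin.succAbove_of_le_castSucc _ _ (Fin.le_def.mpr (by have := Fin.lt_def.mp h; simp; omega))]
        have h2 : ¬ j < i := not_lt.mpr h.le
        have h3 : (j : ℕ) ≠ i := fun h' => h.ne' (Fin.ext h')
        simp [faceTuple, hi, h.ne', h2, h3]
    simp only [this, Finset.prod_mul_distrib, Finset.prod_ite_eq', Finset.mem_univ, if_true]

theorem face_mem_weightPart (w n : ℕ) (i : Fin (n + 2)) :
    ∀ x ∈ weightPart k d w (n + 1), face k (TruncPoly k d) n i x ∈ weightPart k d w n := by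
  intro x hx
  induction hx using Submodule.span_induction with
  | mem x hx =>
    obtain ⟨e, he, rfl⟩ := hx
    refine Submodule.subset_span ⟨fun j =>
      (faceTuple i (fun l => Multiplicative.ofAdd (e l)) j).toAdd, ?_, ?_⟩
    · have h := congrArg (fun m => Finsupp.degree m.toAdd)
        (prod_faceTuple i fun l => Multiplicative.ofAdd (e l))
      simpa [toAdd_prod, he] using h
    · rw [face_tprod]
      congr 1
      funext j
      simp only [faceTuple]
      split_ifs <;> simp [mono_add]
  | zero => simp
  | add x y _ _ hx hy => rw [map_add]; exact add_mem hx hy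
  | smul c x _ hx => rw [map_smul]; exact Submodule.smul_mem _ c hx

theorem isStable_weightPart (w : ℕ) : IsStable (weightPart k d w) where
  hochDiff_mem n x hx := by
    rw [hochDiff, LinearMap.sum_apply]
    exact Submodule.sum_mem _ fun i _ =>
      Submodule.smul_mem _ _ (face_mem_weightPart k d w n i x hx)
  barDiff_mem n x hx := by
    rw [barDiff, LinearMap.sum_apply]
    exact Submodule.sum_mem _ fun i _ =>
      Submodule.smul_mem _ _ (face_mem_weightPart k d w n i.castSucc x hx)
  cyclicOp_mem n x hx := by
    induction hx using Submodule.span_induction with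
    | mem x hx =>
      obtain ⟨e, he, rfl⟩ := hx
      rw [cyclicOp, LinearMap.smul_apply, LinearEquiv.coe_coe, PiTensorProduct.reindex_tprod]
      refine Submodule.smul_mem _ _ (Submodule.subset_span
        ⟨fun j => e ((finRotate (n + 1)).symm j), ?_, rfl⟩)
      rw [← he]
      exact Equiv.sum_comp (finRotate (n + 1)).symm fun j => (e j).degree
    | zero => simp
    | add x y _ _ hx hy => rw [map_add]; exact add_mem hx hy
    | smul c x _ hx => rw [map_smul]; exact Submodule.smul_mem _ c hx

/-- The weight `w` part of the periodic cyclic complex of `k[x₁, …, x_d] / (x₁, …, x_d)²`. -/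
def weightComplex (w : ℕ) : ChainComplex (ModuleCat.{u} k) ℤ :=
  periodicSubcomplex (weightPart k d w) (isStable_weightPart k d w)

open CategoryTheory in
/-- The inclusion of the weight `w` subcomplex into the whole periodic cyclic complex. -/
def weightInclusion (w : ℕ) :
    weightComplex k d w ⟶ periodicComplex k (TruncPoly k d) :=
  periodicSubcomplexInclusion (weightPart k d w) (isStable_weightPart k d w)

/-- `HPₙ^{(w)}(A)`: the homology of the weight `w` subcomplex. -/
abbrev HPWeight (w : ℕ) (n : ℤ) : ModuleCat.{u} k :=
  (weightComplex k d w).homology n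

end Truncated

end
end CyclicHomology

/-! The proof is Goodwillie's argument: a derivation acts trivially on periodic cyclic homology, up
to control over denominators. In `A` all products of two elements of the augmentation ideal vanish,
so `D`, the projection onto the span of the variables, is a derivation (`euler_mul`). It acts on
tensors of weight `w` as multiplication by `w` (`lieOp_apply_of_mem`). A null-homotopy of this
action would kill every positive weight over `ℚ`.

The homotopy `h` has two kinds of components. Along the rows, the operator `D` on the last factor
and a telescoping sum of its rotations contract onto the action of `D` (`horiz_rowHomotopy`).
Between neighbouring rows, contraction with `D` anticommutes with the vertical differential
(`vert_cap`). This gives `dh + hd = L + δ` (`totalD_totalHomotopy`), where `δ` is an error term. It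
is left uncorrected, because it lands only in odd columns and shifts the column by one, so `δ² = 0`
(`totalDefect_totalDefect`). If `G` divides by the weight, `x` is a cycle and `x₀` is its weight `0`
part, then `d h G x = x - x₀ + δ G x`. Here `δ G x` is again a cycle, and a second application of
the formula removes it: `x - x₀ = d h G (x - δ G x)` (`totalD_positiveWeightPrimitive`).

What is left is weight `0`, spanned in each row by `1 ⊗ ⋯ ⊗ 1`. There the total differential out of
odd degrees is zero. Out of even degrees it is a two-term expression in consecutive coefficients,
where the coefficient `c (q + 1)` has a factor `±1`. It is therefore onto, and its kernel is the
line parametrised by `c 0`. -/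

namespace CyclicHomology
noncomputable section
open scoped TensorProduct
universe u

/-! ### A derivation acting on one tensor factor, and contraction with it -/

section Slot

variable {k A : Type*} [CommRing k] [Ring A] [Algebra k A] (D : A →ₗ[k] A)

/-- The endomorphism of `A^{⊗ (n + 1)}` that applies `D` to the `j`-th tensor factor. -/
def slot (n : ℕ) (j : Fin (n + 1)) : Module.End k (Tens k A n) :=
  PiTensorProduct.map fun i => if i = j then D else LinearMap.id

theorem slot_tprod (n : ℕ) (j : Fin (n + 1)) (a : Fin (n + 1) → A) :
    slot D n j (PiTensorProduct.tprod k a) =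
      PiTensorProduct.tprod k (Function.update a j (D (a j))) := by
  rw [slot, PiTensorProduct.map_tprod]
  congr 1
  funext i
  by_cases h : i = j
  · subst h; simp
  · simp [h]

/-- To the left of `i` the face does not change the entries, except that the cyclic face multiplies
at position `0`. The hypothesis `h'` excludes that position. -/
theorem faceTuple_update_of_lt {n : ℕ} (i : Fin (n + 2)) (j : Fin (n + 1)) (h : (j : ℕ) < i)
    (h' : i = Fin.last (n + 1) → j ≠ 0) (a : Fin (n + 2) → A) :
    Function.update (faceTuple i a) j (D (faceTuple i a j)) =
      faceTuple i (Function.update a j.castSucc (D (a j.castSucc))) := by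
  funext l
  simp only [faceTuple, Function.update_apply, Fin.ext_iff, Fin.val_last, Fin.val_succ,
    Fin.val_castSucc, Fin.val_zero, ne_eq] at *
  grind

theorem faceTuple_update_of_gt {n : ℕ} (i : Fin (n + 2)) (j : Fin (n + 1)) (h : (i : ℕ) < j)
    (a : Fin (n + 2) → A) :
    Function.update (faceTuple i a) j (D (faceTuple i a j)) =
      faceTuple i (Function.update a j.succ (D (a j.succ))) := by
  funext l
  simp only [faceTuple, Function.update_apply, Fin.ext_iff, Fin.val_last, Fin.val_succ,
    Fin.val_castSucc, Fin.val_zero] at *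
  grind

theorem slot_comp_face_of_lt (n : ℕ) (i : Fin (n + 2)) (j : Fin (n + 1)) (h : (j : ℕ) < i)
    (h' : i = Fin.last (n + 1) → j ≠ 0) :
    slot D n j ∘ₗ face k A n i = face k A n i ∘ₗ slot D (n + 1) j.castSucc := by
  refine PiTensorProduct.ext (MultilinearMap.ext fun a => ?_)
  simp only [LinearMap.compMultilinearMap_apply, LinearMap.comp_apply, face_tprod, slot_tprod,
    faceTuple_update_of_lt D i j h h']

theorem slot_comp_face_of_gt (n : ℕ) (i : Fin (n + 2)) (j : Fin (n + 1)) (h : (i : ℕ) < j) :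
    slot D n j ∘ₗ face k A n i = face k A n i ∘ₗ slot D (n + 1) j.succ := by
  refine PiTensorProduct.ext (MultilinearMap.ext fun a => ?_)
  simp only [LinearMap.compMultilinearMap_apply, LinearMap.comp_apply, face_tprod, slot_tprod,
    faceTuple_update_of_gt D i j h]

/-- The Leibniz rule on the face that multiplies the factors `i` and `i + 1`. -/
theorem slot_comp_face_self (hD : ∀ x y, D (x * y) = D x * y + x * D y) (n : ℕ)
    (i : Fin (n + 1)) :
    slot D n i ∘ₗ face k A n i.castSucc =
      face k A n i.castSucc ∘ₗ (slot D (n + 1) i.castSucc + slot D (n + 1) i.succ) := by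
  refine PiTensorProduct.ext (MultilinearMap.ext fun a => ?_)
  have h0 : faceTuple i.castSucc a i = a i.castSucc * a i.succ := by
    simp [faceTuple, Fin.castSucc_ne_last]
  have h1 : faceTuple i.castSucc (Function.update a i.castSucc (D (a i.castSucc))) =
      Function.update (faceTuple i.castSucc a) i (D (a i.castSucc) * a i.succ) := by
    funext l
    simp only [faceTuple, Function.update_apply, Fin.ext_iff, Fin.val_last, Fin.val_succ,
      Fin.val_castSucc, Fin.val_zero] at *
    grind
  have h2 : faceTuple i.castSucc (Function.update a i.succ (D (a i.succ))) =
      Function.update (faceTuple i.castSucc a) i (a i.castSucc * D (a i.succ)) := by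
    funext l
    simp only [faceTuple, Function.update_apply, Fin.ext_iff, Fin.val_last, Fin.val_succ,
      Fin.val_castSucc, Fin.val_zero] at *
    grind
  simp only [LinearMap.compMultilinearMap_apply, LinearMap.comp_apply, LinearMap.add_apply,
    map_add, face_tprod, slot_tprod, h0, hD, h1, h2, MultilinearMap.map_update_add]

theorem slot_comp_cyclicOp (n : ℕ) (j : Fin (n + 1)) :
    slot D n (finRotate (n + 1) j) ∘ₗ cyclicOp k A n = cyclicOp k A n ∘ₗ slot D n j := by
  refine PiTensorProduct.ext (MultilinearMap.ext fun a => ?_)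
  simp only [LinearMap.compMultilinearMap_apply, LinearMap.comp_apply, cyclicOp,
    LinearMap.smul_apply, LinearEquiv.coe_coe, PiTensorProduct.reindex_tprod, map_smul, slot_tprod]
  congr 2
  funext i
  simp only [Function.update_apply, Equiv.symm_apply_apply, Equiv.symm_apply_eq]

/-- `D` applied to the last tensor factor. -/
abbrev lastSlot (n : ℕ) : Module.End k (Tens k A n) := slot D n (Fin.last n)

/-- The sign `(-1)ⁿ` times `(a₀, …, aₙ₊₁) ↦ (D aₙ₊₁ a₀, a₁, …, aₙ)`. -/
def capEven (n : ℕ) : Tens k A (n + 1) →ₗ[k] Tens k A n :=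
  (-1 : k) ^ n • (face k A n (Fin.last (n + 1)) ∘ₗ lastSlot D (n + 1))

/-- The sign `(-1)ⁿ` times `(a₀, …, aₙ₊₁) ↦ (a₀, a₁, …, D aₙ aₙ₊₁)`. -/
def capOdd (n : ℕ) : Tens k A (n + 1) →ₗ[k] Tens k A n :=
  (-1 : k) ^ n • (face k A n (Fin.last n).castSucc ∘ₗ slot D (n + 1) (Fin.last n).castSucc)

theorem hochDiff_split (n : ℕ) : hochDiff k A (n + 1) =
    (∑ i : Fin (n + 1), (-1 : k) ^ (i : ℕ) • face k A (n + 1) i.castSucc.castSucc) +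
      (-1 : k) ^ (n + 1) • face k A (n + 1) (Fin.last (n + 1)).castSucc +
      (-1 : k) ^ (n + 2) • face k A (n + 1) (Fin.last (n + 2)) := by
  rw [hochDiff, Fin.sum_univ_castSucc, Fin.sum_univ_castSucc]
  rfl

theorem barDiff_split (n : ℕ) : barDiff k A (n + 1) =
    (∑ i : Fin (n + 1), (-1 : k) ^ (i : ℕ) • face k A (n + 1) i.castSucc.castSucc) +
      (-1 : k) ^ (n + 1) • face k A (n + 1) (Fin.last (n + 1)).castSucc := by
  rw [barDiff, Fin.sum_univ_castSucc]
  rfl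

/-- Faces below `n + 1` commute with the contraction. On the two remaining faces the Leibniz rule
produces `D` on the factors `n + 1` and `n + 2`. The terms in the factor `n + 1` occur twice with
opposite signs and cancel. The sign in `capEven` turns commutation into anticommutation. -/
theorem capEven_hochDiff (hD : ∀ x y, D (x * y) = D x * y + x * D y) (n : ℕ) :
    hochDiff k A n ∘ₗ capEven D (n + 1) + capEven D n ∘ₗ hochDiff k A (n + 1) = 0 := by
  have e1 : ∀ i : Fin (n + 1),
      face k A n i.castSucc ∘ₗ face k A (n + 1) (Fin.last (n + 2)) ∘ₗ lastSlot D (n + 2) =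
      (face k A n (Fin.last (n + 1)) ∘ₗ lastSlot D (n + 1)) ∘ₗ
        face k A (n + 1) i.castSucc.castSucc := by
    intro i
    have h1 := face_comp_face k A n (Fin.last (n + 1)) i.castSucc.castSucc
      (by simp only [Fin.val_castSucc, Fin.val_last]; omega)
    have h2 := slot_comp_face_of_gt D (n + 1) i.castSucc.castSucc (Fin.last (n + 1))
      (by simp only [Fin.val_castSucc, Fin.val_last]; omega)
    rw [LinearMap.comp_assoc, h2, ← LinearMap.comp_assoc, ← LinearMap.comp_assoc, h1]
    rfl
  have e2 := slot_comp_face_self D hD (n + 1) (Fin.last (n + 1))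
  have e3 := slot_comp_face_of_lt D (n + 1) (Fin.last (n + 2)) (Fin.last (n + 1)) (by simp)
    (fun _ => by simp [Fin.ext_iff])
  have e4 := face_comp_face k A n (Fin.last (n + 1)) (Fin.last (n + 1)).castSucc (by simp)
  have e5 : hochDiff k A n ∘ₗ face k A (n + 1) (Fin.last (n + 2)) ∘ₗ lastSlot D (n + 2) =
      (face k A n (Fin.last (n + 1)) ∘ₗ lastSlot D (n + 1)) ∘ₗ hochDiff k A (n + 1) := by
    rw [hochDiff_split, hochDiff, Fin.sum_univ_castSucc, LinearMap.add_comp, sum_comp_right]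
    simp only [LinearMap.comp_add, comp_sum_left, LinearMap.smul_comp, LinearMap.comp_smul,
      Fin.val_castSucc, e1]
    rw [add_assoc (Finset.sum _ _)]
    congr 1
    rw [LinearMap.comp_assoc, LinearMap.comp_assoc, e2, e3, ← LinearMap.comp_assoc,
      ← LinearMap.comp_assoc, ← LinearMap.comp_assoc, e4, Fin.succ_last]
    rw [show (Fin.castLT (Fin.last (n + 1)).castSucc _ : Fin (n + 2)) = Fin.last (n + 1) from rfl]
    refine LinearMap.ext fun x => ?_
    simp only [LinearMap.comp_add, LinearMap.add_apply, LinearMap.smul_apply, pow_succ,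
      Fin.val_last]
    module
  simp only [capEven, LinearMap.comp_smul, LinearMap.smul_comp, e5]
  refine LinearMap.ext fun x => ?_
  simp only [LinearMap.add_apply, LinearMap.smul_apply, LinearMap.zero_apply, pow_succ]
  module

/-- The cancellation is that of `capEven_hochDiff`, moved one factor to the left: it takes place on
the faces `n` and `n + 1`, and no cyclic face is involved. -/
theorem capOdd_barDiff (hD : ∀ x y, D (x * y) = D x * y + x * D y) (n : ℕ) :
    barDiff k A n ∘ₗ capOdd D (n + 1) + capOdd D n ∘ₗ barDiff k A (n + 1) = 0 := by
  have e1 : ∀ i : Fin n,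
      face k A n i.castSucc.castSucc ∘ₗ face k A (n + 1) (Fin.last (n + 1)).castSucc ∘ₗ
        slot D (n + 2) (Fin.last (n + 1)).castSucc =
      (face k A n (Fin.last n).castSucc ∘ₗ slot D (n + 1) (Fin.last n).castSucc) ∘ₗ
        face k A (n + 1) i.castSucc.castSucc.castSucc := by
    intro i
    have h1 := face_comp_face k A n (Fin.last n).castSucc i.castSucc.castSucc.castSucc
      (by simp only [Fin.val_castSucc, Fin.val_last]; omega)
    have h2 := slot_comp_face_of_gt D (n + 1) i.castSucc.castSucc.castSucc (Fin.last n).castSucc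
      (by simp)
    rw [LinearMap.comp_assoc, h2, ← LinearMap.comp_assoc, ← LinearMap.comp_assoc, h1]
    rfl
  have e2 := slot_comp_face_self D hD (n + 1) (Fin.last n).castSucc
  have e3 := slot_comp_face_of_lt D (n + 1) (Fin.last (n + 1)).castSucc (Fin.last n).castSucc
    (by simp) (fun h => by simp [Fin.ext_iff] at h)
  have e4 := face_comp_face k A n (Fin.last n).castSucc (Fin.last n).castSucc.castSucc (by simp)
  have e5 : barDiff k A n ∘ₗ face k A (n + 1) (Fin.last (n + 1)).castSucc ∘ₗ
        slot D (n + 2) (Fin.last (n + 1)).castSucc =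
      (face k A n (Fin.last n).castSucc ∘ₗ slot D (n + 1) (Fin.last n).castSucc) ∘ₗ
        barDiff k A (n + 1) := by
    rw [barDiff_split, barDiff, Fin.sum_univ_castSucc, LinearMap.add_comp, sum_comp_right,
      Fin.sum_univ_castSucc]
    simp only [LinearMap.comp_add, comp_sum_left, LinearMap.smul_comp, LinearMap.comp_smul,
      Fin.val_castSucc, e1]
    rw [add_assoc (Finset.sum _ _)]
    congr 1
    rw [LinearMap.comp_assoc, LinearMap.comp_assoc, e2, e3, ← LinearMap.comp_assoc,
      ← LinearMap.comp_assoc, ← LinearMap.comp_assoc, e4]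
    rw [show (Fin.castLT (Fin.last n).castSucc.castSucc _ : Fin (n + 2)) =
        (Fin.last n).castSucc from rfl,
      show (Fin.last n).castSucc.succ = (Fin.last (n + 1)).castSucc from rfl]
    refine LinearMap.ext fun x => ?_
    simp only [LinearMap.comp_add, LinearMap.add_apply, LinearMap.smul_apply, pow_succ,
      Fin.val_last]
    module
  simp only [capOdd, LinearMap.comp_smul, LinearMap.smul_comp, e5]
  refine LinearMap.ext fun x => ?_
  simp only [LinearMap.add_apply, LinearMap.smul_apply, LinearMap.zero_apply, pow_succ]
  module

theorem lastSlot_comp_cyclicOp (n : ℕ) :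
    lastSlot D (n + 1) ∘ₗ cyclicOp k A (n + 1) =
      cyclicOp k A (n + 1) ∘ₗ slot D (n + 1) (Fin.last n).castSucc := by
  have h := slot_comp_cyclicOp D (n + 1) (Fin.last n).castSucc
  rwa [show finRotate (n + 1 + 1) (Fin.last n).castSucc = Fin.last (n + 1) by
    rw [finRotate_apply, Fin.coeSucc_eq_succ, Fin.succ_last]] at h

/-- The operator `t` carries `capOdd` to `-capEven`, so the first two terms add up to `capEven +
capOdd`. In the difference of the last two, only the Leibniz term of face `n` and the cyclic face of
`b` survive, and they give the negative of that sum. -/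
theorem cap_one_sub_cyclicOp (hD : ∀ x y, D (x * y) = D x * y + x * D y) (n : ℕ) :
    capEven D n ∘ₗ (1 - cyclicOp k A (n + 1)) + (1 - cyclicOp k A n) ∘ₗ capOdd D n +
      hochDiff k A n ∘ₗ lastSlot D (n + 1) - lastSlot D n ∘ₗ barDiff k A n = 0 := by
  have h1 : capEven D n ∘ₗ cyclicOp k A (n + 1) = -(cyclicOp k A n ∘ₗ capOdd D n) := by
    rw [capEven, capOdd, LinearMap.smul_comp, LinearMap.comp_assoc, lastSlot_comp_cyclicOp,
      ← LinearMap.comp_assoc, ← Fin.succ_last, face_succ_comp_cyclicOp, LinearMap.neg_comp,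
      LinearMap.comp_smul, LinearMap.comp_assoc, smul_neg]
  have h2 : hochDiff k A n ∘ₗ lastSlot D (n + 1) - lastSlot D n ∘ₗ barDiff k A n =
      -(capEven D n) - capOdd D n := by
    have e1 : ∀ i : Fin n, lastSlot D n ∘ₗ face k A n i.castSucc.castSucc =
        face k A n i.castSucc.castSucc ∘ₗ lastSlot D (n + 1) := fun i => by
      rw [slot_comp_face_of_gt _ _ _ _ (by simp), Fin.succ_last]
    have e2 := slot_comp_face_self D hD n (Fin.last n)
    rw [hochDiff, barDiff, Fin.sum_univ_castSucc, Fin.sum_univ_castSucc, Fin.sum_univ_castSucc]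
    simp only [LinearMap.comp_add, LinearMap.add_comp, comp_sum_left, sum_comp_right,
      LinearMap.smul_comp, LinearMap.comp_smul, Fin.val_castSucc, e1, e2, Fin.val_last, capEven,
      capOdd, Fin.succ_last]
    refine LinearMap.ext fun x => ?_
    simp only [LinearMap.add_apply, LinearMap.sub_apply, LinearMap.neg_apply,
      LinearMap.smul_apply, pow_succ]
    module
  rw [LinearMap.comp_sub, LinearMap.sub_comp, h1, add_sub_assoc, h2, Module.End.one_eq_id,
    Module.End.one_eq_id, LinearMap.comp_id, LinearMap.id_comp]
  refine LinearMap.ext fun x => ?_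
  simp only [LinearMap.add_apply, LinearMap.sub_apply, LinearMap.neg_apply, LinearMap.zero_apply]
  abel

/-! ### Homotopy along the rows; `t ^ n` plays the role of the inverse of `t` -/

/-- The action of `D` on `A^{⊗ (n + 1)}` as a derivation, see `lieOp_eq_sum_slot`. -/
def lieOp (n : ℕ) : Module.End k (Tens k A n) :=
  ∑ i ∈ Finset.range (n + 1), (cyclicOp k A n ^ n) ^ i * lastSlot D n * cyclicOp k A n ^ i

/-- The component from even to odd columns of the homotopy for `lieOp`. -/
def cyclicHomotopy (n : ℕ) : Module.End k (Tens k A n) :=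
  ∑ i ∈ Finset.range (n + 1), (∑ m ∈ Finset.range i, (cyclicOp k A n ^ n) ^ (m + 1)) *
    lastSlot D n * cyclicOp k A n ^ i

end Slot

theorem one_sub_mul_sum_inverse_pow {R : Type*} [Ring R] (t u : R) (htu : t * u = 1) (i : ℕ) :
    (1 - t) * ∑ m ∈ Finset.range i, u ^ (m + 1) = u ^ i - 1 := by
  rw [sub_mul, one_mul, Finset.mul_sum]
  simp only [pow_succ' u, ← mul_assoc, htu, one_mul]
  rw [← Finset.sum_sub_distrib]
  simp only [← pow_succ']
  rw [Finset.sum_range_sub (fun m => u ^ m) i, pow_zero]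

section Slot

variable {k A : Type*} [CommRing k] [Ring A] [Algebra k A] (D : A →ₗ[k] A)

theorem one_sub_cyclicOp_mul_cyclicHomotopy (n : ℕ) :
    (1 - cyclicOp k A n) * cyclicHomotopy D n + lastSlot D n * normOp k A n = lieOp D n := by
  rw [cyclicHomotopy, lieOp, normOp, Finset.mul_sum, Finset.mul_sum, ← Finset.sum_add_distrib]
  refine Finset.sum_congr rfl fun i _ => ?_
  rw [← mul_assoc, ← mul_assoc, one_sub_mul_sum_inverse_pow _ _
    ((pow_succ' _ _).symm.trans (cyclicOp_pow k A n))]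
  rw [sub_mul, sub_mul, one_mul, sub_add_cancel]

/-- Here `1 - t` stands on the right, away from the inner geometric sums, so the telescoping is a
summation by parts in the outer index. -/
theorem cyclicHomotopy_mul_one_sub_cyclicOp (n : ℕ) :
    cyclicHomotopy D n * (1 - cyclicOp k A n) + normOp k A n * lastSlot D n = lieOp D n := by
  -- Powers of the inverse of `t` run through the powers of `t` in reverse order.
  have hN : normOp k A n = ∑ m ∈ Finset.range (n + 1), (cyclicOp k A n ^ n) ^ m := by
    rw [normOp, Finset.sum_range_succ', Finset.sum_range_succ', ← Finset.sum_range_reflect]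
    congr 1
    refine Finset.sum_congr rfl fun m hm => ?_
    have hm' := Finset.mem_range.mp hm
    rw [← pow_mul, show n * (m + 1) = (n - 1 - m + 1) + (n + 1) * m by
      obtain ⟨c, rfl⟩ : ∃ c, n = m + 1 + c := ⟨n - (m + 1), by omega⟩
      rw [show m + 1 + c - 1 - m = c by omega]
      ring, pow_add _ _ ((n + 1) * m), pow_mul _ (n + 1), cyclicOp_pow, one_pow, mul_one]
  rw [hN, cyclicHomotopy, lieOp]
  generalize hu : cyclicOp k A n ^ n = u
  have ht : cyclicOp k A n ^ (n + 1) = 1 := cyclicOp_pow k A n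
  generalize cyclicOp k A n = t at *
  generalize lastSlot D n = P
  -- The sums are cut off at `r` to allow induction. At `r = n` the relation `t ^ (n + 1) = 1`
  -- cancels the boundary terms `-P` and `P * t ^ (r + 1)`.
  have key : ∀ r : ℕ, (∑ i ∈ Finset.range (r + 1),
      (∑ m ∈ Finset.range i, u ^ (m + 1)) * P * t ^ i) * (1 - t) +
        (∑ m ∈ Finset.range (r + 1), u ^ m) * P * t ^ (r + 1) =
      ∑ i ∈ Finset.range (r + 1), u ^ i * P * t ^ i - P + P * t ^ (r + 1) := by
    intro r
    induction r with
    | zero => simp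
    | succ r ih =>
      have hX : ∑ m ∈ Finset.range (r + 1), u ^ (m + 1) =
          ∑ m ∈ Finset.range (r + 1), u ^ m + u ^ (r + 1) - 1 := by
        rw [← Finset.sum_range_succ, Finset.sum_range_succ' _ (r + 1), pow_zero,
          add_sub_cancel_right]
      rw [Finset.sum_range_succ, add_mul, eq_sub_of_add_eq ih,
        Finset.sum_range_succ' (fun m => u ^ m) (r + 1), hX,
        Finset.sum_range_succ (fun i => u ^ i * P * t ^ i) (r + 1), pow_zero]
      generalize ∑ m ∈ Finset.range (r + 1), u ^ m = Y
      simp only [pow_succ t, mul_assoc, add_mul, sub_mul, mul_sub, one_mul, mul_one]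
      abel
  have h := key n
  rwa [ht, mul_one, mul_one, sub_add_cancel] at h

end Slot

/-! ### Cartan's formula on the total complex, with a defect of square zero -/

section Cartan

variable {k A : Type*} [CommRing k] [Ring A] [Algebra k A] (D : A →ₗ[k] A)

/-- Conjugation by `t` moves the factor on which `D` acts by one place, so the summands of `lieOp`
are the individual slots. -/
theorem lastSlot_mul_cyclicOp_pow (n i : ℕ) (hi : i < n + 1) :
    lastSlot D n * cyclicOp k A n ^ i = cyclicOp k A n ^ i * slot D n (Fin.rev ⟨i, hi⟩) := by
  induction i with
  | zero =>
    rw [pow_zero, mul_one, one_mul]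
    rfl
  | succ i ih =>
    have h := slot_comp_cyclicOp D n (Fin.rev ⟨i + 1, hi⟩)
    have e : finRotate (n + 1) (Fin.rev ⟨i + 1, hi⟩) = Fin.rev ⟨i, by omega⟩ := by
      rw [Fin.ext_iff, coe_finRotate_of_ne_last]
      · simp only [Fin.val_rev]
        omega
      · rw [ne_eq, Fin.ext_iff, Fin.val_rev, Fin.val_last]
        simp only
        omega
    rw [e] at h
    rw [pow_succ, ← mul_assoc, ih (by omega), mul_assoc, mul_assoc]
    exact congrArg _ h

theorem lieOp_eq_sum_slot (n : ℕ) : lieOp D n = ∑ j, slot D n j := by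
  rw [lieOp, Finset.sum_range, ← Equiv.sum_comp Fin.revPerm (slot D n)]
  refine Finset.sum_congr rfl fun i _ => ?_
  rw [mul_assoc, lastSlot_mul_cyclicOp_pow D n i i.isLt, ← mul_assoc, ← pow_mul, ← pow_add,
    show n * (i : ℕ) + i = (n + 1) * i by ring, pow_mul, cyclicOp_pow, one_pow, one_mul]
  rfl

/-- The component of the Cartan homotopy from position `(p, n + 1)` to `(p + 2, n)`. -/
def cap (p : ℤ) (n : ℕ) : Tens k A (n + 1) →ₗ[k] Tens k A n :=
  if Even p then capEven D n else capOdd D n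

/-- The component of the Cartan homotopy from position `(p, n)` to `(p + 1, n)`. -/
def rowHomotopy (p : ℤ) (n : ℕ) : Module.End k (Tens k A n) :=
  if Even p then cyclicHomotopy D n else lastSlot D n

/-- The defect in Cartan's formula, from position `(p - 1, n + 1)` to `(p, n)`. -/
def cartanDefect (p : ℤ) (n : ℕ) : Tens k A (n + 1) →ₗ[k] Tens k A n :=
  if Even p then 0 else
    normOp k A n ∘ₗ capEven D n + capOdd D n ∘ₗ normOp k A (n + 1) -
      barDiff k A n ∘ₗ cyclicHomotopy D (n + 1) + cyclicHomotopy D n ∘ₗ hochDiff k A n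

theorem vert_cap (hD : ∀ x y, D (x * y) = D x * y + x * D y) (p : ℤ) (n : ℕ) :
    vert k A p n ∘ₗ cap D p (n + 1) + cap D p n ∘ₗ vert k A p (n + 1) = 0 := by
  unfold vert cap
  split_ifs
  · exact capEven_hochDiff D hD n
  · rw [LinearMap.neg_comp, LinearMap.comp_neg, ← neg_add, capOdd_barDiff D hD n, neg_zero]

theorem horiz_rowHomotopy (p : ℤ) (n : ℕ) :
    horiz k A (p + 1) n ∘ₗ rowHomotopy D p n + rowHomotopy D (p - 1) n ∘ₗ horiz k A p n =
      lieOp D n := by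
  unfold horiz rowHomotopy
  by_cases hp : Even p
  · rw [if_pos hp, if_pos hp, if_neg (by simpa [Int.even_add_one] using hp),
      if_neg (by simpa [Int.even_sub_one] using hp)]
    exact one_sub_cyclicOp_mul_cyclicHomotopy D n
  · rw [if_neg hp, if_neg hp, if_pos (by simpa [Int.even_add_one] using hp),
      if_pos (by simpa [Int.even_sub_one] using hp)]
    exact (add_comm _ _).trans (cyclicHomotopy_mul_one_sub_cyclicOp D n)

/-- For even `p` this is `cap_one_sub_cyclicOp`. For odd `p` nothing is claimed: the left side is
the defect by definition. -/
theorem cap_horiz_vert_rowHomotopy (hD : ∀ x y, D (x * y) = D x * y + x * D y) (p : ℤ) (n : ℕ) :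
    vert k A p n ∘ₗ rowHomotopy D (p - 1) (n + 1) + horiz k A (p + 1) n ∘ₗ cap D (p - 1) n +
      (cap D p n ∘ₗ horiz k A (p - 1) (n + 1) + rowHomotopy D (p - 1) n ∘ₗ vert k A (p - 1) n) =
      cartanDefect D p n := by
  unfold horiz rowHomotopy cartanDefect vert cap
  by_cases hp : Even p
  · have h1 : ¬ Even (p + 1) := by simpa [Int.even_add_one] using hp
    have h2 : ¬ Even (p - 1) := by simpa [Int.even_sub_one] using hp
    simp only [if_pos hp, if_neg h1, if_neg h2]
    rw [← cap_one_sub_cyclicOp D hD n]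
    refine LinearMap.ext fun x => ?_
    simp only [LinearMap.add_apply, LinearMap.sub_apply, LinearMap.comp_neg, LinearMap.neg_apply]
    abel
  · have h1 : Even (p + 1) := by simpa [Int.even_add_one] using hp
    have h2 : Even (p - 1) := by simpa [Int.even_sub_one] using hp
    simp only [if_neg hp, if_pos h1, if_pos h2]
    refine LinearMap.ext fun x => ?_
    simp only [LinearMap.add_apply, LinearMap.sub_apply, LinearMap.neg_comp, LinearMap.neg_apply]
    abel

/-- The Cartan homotopy for `D`, from degree `n` to degree `n + 1` of the total complex. -/
def totalHomotopy (n : ℤ) : Total k A →ₗ[k] Total k A :=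
  LinearMap.pi fun q =>
    cap D (n - q - 1) q ∘ₗ LinearMap.proj (q + 1) + rowHomotopy D (n - q) q ∘ₗ LinearMap.proj q

/-- The defect in Cartan's formula on the total complex. -/
def totalDefect (n : ℤ) : Total k A →ₗ[k] Total k A :=
  LinearMap.pi fun q => cartanDefect D (n - q) q ∘ₗ LinearMap.proj (q + 1)

theorem totalHomotopy_apply (n : ℤ) (x : Total k A) (q : ℕ) :
    totalHomotopy D n x q = cap D (n - q - 1) q (x (q + 1)) + rowHomotopy D (n - q) q (x q) := rfl

theorem totalDefect_apply (n : ℤ) (x : Total k A) (q : ℕ) :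
    totalDefect D n x q = cartanDefect D (n - q) q (x (q + 1)) := rfl

theorem cap_congr {p p' : ℤ} (h : Even p ↔ Even p') (n : ℕ) : cap D p n = cap D p' n := by
  simp only [cap, h]

/-- Cartan's formula, up to the defect. -/
theorem totalD_totalHomotopy (hD : ∀ x y, D (x * y) = D x * y + x * D y) (n : ℤ)
    (x : Total k A) (q : ℕ) :
    totalD k A n (totalHomotopy D n x) q + totalHomotopy D (n - 1) (totalD k A (n - 1) x) q =
      lieOp D q (x q) + totalDefect D n x q := by
  -- Row `q` receives contributions from rows `q + 2`, `q + 1` and `q`, and each of the three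
  -- identities settles one of them.
  have h1 := LinearMap.congr_fun (vert_cap D hD (n - q) q) (x (q + 2))
  have h2 := LinearMap.congr_fun (cap_horiz_vert_rowHomotopy D hD (n - q) q) (x (q + 1))
  have h3 := LinearMap.congr_fun (horiz_rowHomotopy D (n - q) q) (x q)
  have c1 : n - ((q + 1 : ℕ) : ℤ) = n - q - 1 := by push_cast; ring
  have c2 : n - 1 - ((q + 1 : ℕ) : ℤ) = n - q - 2 := by push_cast; ring
  have c3 : n - 1 - (q : ℤ) = n - q - 1 := by ring
  have c4 : n - (q : ℤ) - 2 + 1 = n - q - 1 := by ring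
  have p1 : cap D (n - q - 1 - 1) q = cap D (n - q) q :=
    cap_congr D (by simp) q
  have p2 : cap D (n - q - 1 - 1) (q + 1) = cap D (n - q) (q + 1) :=
    cap_congr D (by simp) _
  have p3 : vert k A (n - q - 2) (q + 1) = vert k A (n - q) (q + 1) := by
    simp only [vert, Int.even_sub, even_two, iff_true]
  simp only [LinearMap.comp_apply, LinearMap.add_apply, LinearMap.zero_apply] at h1 h2 h3
  simp only [totalDefect_apply, totalD_apply, totalHomotopy_apply, map_add, c1, c2, c3, c4, p1, p2,
    p3, sub_add_cancel, ← h2, ← h3]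
  rw [eq_comm, ← sub_eq_zero, ← neg_eq_zero]
  rw [← h1]
  abel

/-- The defect raises the column by one and vanishes into even columns. Of two consecutive steps,
one ends in an even column. -/
theorem totalDefect_totalDefect (n : ℤ) (x : Total k A) :
    totalDefect D n (totalDefect D n x) = 0 := by
  funext q
  rw [totalDefect_apply, totalDefect_apply]
  by_cases h : Even (n - (q : ℤ))
  · simp only [cartanDefect, if_pos h, LinearMap.zero_apply, Pi.zero_apply]
  · have h' : Even (n - ((q + 1 : ℕ) : ℤ)) := by
      have : n - ((q + 1 : ℕ) : ℤ) = n - q - 1 := by push_cast; ring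
      rw [this, Int.even_sub_one]
      exact h
    simp only [cartanDefect, if_pos h', LinearMap.zero_apply, map_zero, Pi.zero_apply]

/-- The endomorphism of the total complex given by an endomorphism of every tensor power. -/
def totalMap (Φ : ∀ q, Module.End k (Tens k A q)) : Total k A →ₗ[k] Total k A :=
  LinearMap.pi fun q => Φ q ∘ₗ LinearMap.proj q

theorem totalMap_apply (Φ : ∀ q, Module.End k (Tens k A q)) (x : Total k A) (q : ℕ) :
    totalMap Φ x q = Φ q (x q) := rfl

end Cartan

/-! ### The Euler derivation and the weight decomposition -/

section Euler

variable (k : Type u) [CommRing k] (d : ℕ)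

/-- The augmentation `xᵢ ↦ 0` of `k[x₁, …, x_d] / (x₁, …, x_d)²`. -/
def augmentation : TruncPoly k d →ₐ[k] k :=
  Ideal.Quotient.liftₐ _ (MvPolynomial.aeval fun _ => (0 : k)) fun a ha => by
    have h : Ideal.span (Set.range (MvPolynomial.X : Fin d → MvPolynomial (Fin d) k)) ≤
        RingHom.ker (MvPolynomial.aeval fun _ => (0 : k)) := by
      rw [Ideal.span_le]
      rintro _ ⟨i, rfl⟩
      simp
    exact h (Ideal.pow_le_self two_ne_zero ha)

theorem augmentation_mk (p : MvPolynomial (Fin d) k) :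
    augmentation k d (Ideal.Quotient.mk _ p) = MvPolynomial.constantCoeff p := by
  change MvPolynomial.aeval (fun _ => (0 : k)) p = _
  exact MvPolynomial.aeval_zero' p

theorem augmentation_mono (e : Fin d →₀ ℕ) :
    augmentation k d (mono k d e) = if e = 0 then 1 else 0 := by
  rw [mono, augmentation_mk, MvPolynomial.constantCoeff_monomial]

/-- The projection of `k[x₁, …, x_d] / (x₁, …, x_d)²` onto the span of the variables. It is
the Euler derivation, see `euler_mono` and `euler_mul`. -/
def euler : TruncPoly k d →ₗ[k] TruncPoly k d :=
  LinearMap.id - Algebra.linearMap k _ ∘ₗ (augmentation k d).toLinearMap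

theorem euler_apply (a : TruncPoly k d) :
    euler k d a = a - algebraMap k _ (augmentation k d a) := rfl

theorem mono_zero : mono k d 0 = 1 := rfl

theorem sub_C_constantCoeff_mem (p : MvPolynomial (Fin d) k) :
    p - MvPolynomial.C (MvPolynomial.constantCoeff p) ∈
      Ideal.span (Set.range (MvPolynomial.X : Fin d → MvPolynomial (Fin d) k)) := by
  induction p using MvPolynomial.induction_on with
  | C a => simp
  | add p q hp hq =>
    rw [map_add, map_add, add_sub_add_comm]
    exact add_mem hp hq
  | mul_X p i _ =>
    simp only [map_mul, MvPolynomial.constantCoeff_X, mul_zero, map_zero, sub_zero]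
    exact Ideal.mul_mem_left _ _ (Ideal.subset_span ⟨i, rfl⟩)

theorem euler_mul_euler (a b : TruncPoly k d) : euler k d a * euler k d b = 0 := by
  obtain ⟨p, rfl⟩ := Ideal.Quotient.mk_surjective a
  obtain ⟨q, rfl⟩ := Ideal.Quotient.mk_surjective b
  rw [euler_apply, euler_apply, augmentation_mk, augmentation_mk]
  refine Ideal.Quotient.eq_zero_iff_mem.mpr ?_
  rw [pow_two]
  exact Ideal.mul_mem_mul (sub_C_constantCoeff_mem k d p) (sub_C_constantCoeff_mem k d q)

/-- The deviation from the Leibniz rule is the product of `euler k d a` and `euler k d b`, which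
lies in the square of the augmentation ideal. -/
theorem euler_mul (a b : TruncPoly k d) :
    euler k d (a * b) = euler k d a * b + a * euler k d b := by
  have h := euler_mul_euler k d a b
  simp only [euler_apply, map_mul] at h ⊢
  linear_combination -h

theorem mono_eq_zero {e : Fin d →₀ ℕ} (he : 2 ≤ e.degree) : mono k d e = 0 := by
  refine Ideal.Quotient.eq_zero_iff_mem.mpr ?_
  have h := MvPolynomial.mem_pow_idealOfVars_iff (σ := Fin d) (R := k) 2
    (MvPolynomial.monomial e 1)
  refine h.mpr fun x hx => ?_
  rw [Finset.mem_singleton.mp (MvPolynomial.support_monomial_subset hx)]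
  exact he

theorem euler_mono (e : Fin d →₀ ℕ) :
    euler k d (mono k d e) = (e.degree : k) • mono k d e := by
  rw [euler_apply, augmentation_mono]
  rcases Nat.lt_or_ge 1 e.degree with h | h
  -- In degree at least `2` the class is zero, so any eigenvalue is correct, in particular the
  -- degree.
  · rw [mono_eq_zero k d h, if_neg]
    · simp
    · rintro rfl; simp at h
  · interval_cases h' : e.degree
    · rw [Finsupp.degree_eq_zero_iff] at h'
      simp [h', mono_zero]
    · rw [if_neg]
      · simp
      · rintro rfl; simp at h'

theorem lieOp_apply_of_mem (w n : ℕ) (x : Tens k (TruncPoly k d) n)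
    (hx : x ∈ weightPart k d w n) : lieOp (euler k d) n x = (w : k) • x := by
  induction hx using Submodule.span_induction with
  | mem x hx =>
    obtain ⟨e, he, rfl⟩ := hx
    rw [lieOp_eq_sum_slot, LinearMap.sum_apply, ← he, Nat.cast_sum, Finset.sum_smul]
    refine Finset.sum_congr rfl fun j _ => ?_
    rw [slot_tprod, euler_mono, MultilinearMap.map_update_smul, Function.update_eq_self]
  | zero => simp
  | add x y _ _ hx hy => rw [map_add, hx, hy, smul_add]
  | smul c x _ hx => rw [map_smul, hx, smul_comm]

/-- By the pigeonhole principle some factor has degree at least `2`. Hence only finitely many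
weights occur in each row, which allows functions of the weight to be polynomials in `lieOp`. -/
theorem weightPart_eq_bot {w n : ℕ} (h : n + 1 < w) : weightPart k d w n = ⊥ := by
  rw [weightPart, Submodule.span_eq_bot]
  rintro x ⟨e, he, rfl⟩
  obtain ⟨j, hj⟩ : ∃ j, 2 ≤ (e j).degree := by
    by_contra! hc
    have : ∑ j, (e j).degree ≤ ∑ j : Fin (n + 1), 1 :=
      Finset.sum_le_sum fun j _ => by have := hc j; omega
    simp at this
    omega
  exact (PiTensorProduct.tprod k).map_coord_zero j (mono_eq_zero k d hj)

theorem iSup_weightPart (n : ℕ) : ⨆ w, weightPart k d w n = ⊤ := by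
  rw [eq_top_iff, ← PiTensorProduct.span_tprod_eq_top, Submodule.span_le]
  rintro _ ⟨a, rfl⟩
  choose p hp using fun j => Ideal.Quotient.mk_surjective (a j)
  have ha : a = fun j => ∑ e ∈ (p j).support, MvPolynomial.coeff e (p j) • mono k d e := by
    funext j
    conv_lhs => rw [← hp j, MvPolynomial.as_sum (p j), map_sum]
    refine Finset.sum_congr rfl fun e _ => ?_
    rw [mono, ← mul_one (MvPolynomial.coeff e (p j)), ← smul_eq_mul, ← MvPolynomial.smul_monomial]
    simp
    rfl
  rw [ha, MultilinearMap.map_sum_finset]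
  refine Submodule.sum_mem _ fun e _ => ?_
  rw [MultilinearMap.map_smul_univ]
  refine Submodule.smul_mem _ _ (Submodule.mem_iSup_of_mem (∑ j, (e j).degree)
    (Submodule.subset_span ⟨e, rfl, rfl⟩))

end Euler

/-! ### All operators in use respect the weight -/

section PreservesWeight

variable {k : Type u} [CommRing k] {d : ℕ}

/-- A map between tensor powers that respects the weight decomposition. -/
def PreservesWeight {m n : ℕ} (T : Tens k (TruncPoly k d) m →ₗ[k] Tens k (TruncPoly k d) n) :
    Prop :=
  ∀ w, ∀ x ∈ weightPart k d w m, T x ∈ weightPart k d w n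

namespace PreservesWeight

variable {l m n : ℕ} {T U : Tens k (TruncPoly k d) m →ₗ[k] Tens k (TruncPoly k d) n}

theorem zero : PreservesWeight (0 : Tens k (TruncPoly k d) m →ₗ[k] Tens k (TruncPoly k d) n) :=
  fun _ _ _ => zero_mem _

theorem one : PreservesWeight (1 : Module.End k (Tens k (TruncPoly k d) m)) :=
  fun _ _ hx => hx

theorem add (hT : PreservesWeight T) (hU : PreservesWeight U) : PreservesWeight (T + U) :=
  fun w x hx => add_mem (hT w x hx) (hU w x hx)

theorem neg (hT : PreservesWeight T) : PreservesWeight (-T) :=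
  fun w x hx => neg_mem (hT w x hx)

theorem sub (hT : PreservesWeight T) (hU : PreservesWeight U) : PreservesWeight (T - U) :=
  fun w x hx => sub_mem (hT w x hx) (hU w x hx)

theorem smul (c : k) (hT : PreservesWeight T) : PreservesWeight (c • T) :=
  fun w x hx => Submodule.smul_mem _ c (hT w x hx)

theorem comp {V : Tens k (TruncPoly k d) n →ₗ[k] Tens k (TruncPoly k d) l}
    (hV : PreservesWeight V) (hT : PreservesWeight T) : PreservesWeight (V ∘ₗ T) :=
  fun w x hx => hV w _ (hT w x hx)

theorem sum {ι : Type*} (s : Finset ι)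
    {F : ι → Tens k (TruncPoly k d) m →ₗ[k] Tens k (TruncPoly k d) n}
    (hF : ∀ i, PreservesWeight (F i)) : PreservesWeight (∑ i ∈ s, F i) := fun w x hx => by
  rw [LinearMap.sum_apply]
  exact Submodule.sum_mem _ fun i _ => hF i w x hx

theorem pow {T : Module.End k (Tens k (TruncPoly k d) m)} (hT : PreservesWeight T) (i : ℕ) :
    PreservesWeight (T ^ i) := by
  induction i with
  | zero => exact one
  | succ i ih => exact comp ih hT

end PreservesWeight

open PreservesWeight

theorem preservesWeight_face (n : ℕ) (i : Fin (n + 2)) :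
    PreservesWeight (face k (TruncPoly k d) n i) :=
  fun w => face_mem_weightPart k d w n i

theorem preservesWeight_hochDiff (n : ℕ) : PreservesWeight (hochDiff k (TruncPoly k d) n) :=
  fun w => (isStable_weightPart k d w).hochDiff_mem n

theorem preservesWeight_barDiff (n : ℕ) : PreservesWeight (barDiff k (TruncPoly k d) n) :=
  fun w => (isStable_weightPart k d w).barDiff_mem n

theorem preservesWeight_cyclicOp (n : ℕ) : PreservesWeight (cyclicOp k (TruncPoly k d) n) :=
  fun w => (isStable_weightPart k d w).cyclicOp_mem n

theorem preservesWeight_normOp (n : ℕ) : PreservesWeight (normOp k (TruncPoly k d) n) :=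
  sum _ fun _ => (preservesWeight_cyclicOp n).pow _

theorem preservesWeight_slot (n : ℕ) (j : Fin (n + 1)) :
    PreservesWeight (slot (euler k d) n j) := by
  intro w x hx
  induction hx using Submodule.span_induction with
  | mem x hx =>
    obtain ⟨e, he, rfl⟩ := hx
    rw [slot_tprod, euler_mono, MultilinearMap.map_update_smul, Function.update_eq_self]
    exact Submodule.smul_mem _ _ (Submodule.subset_span ⟨e, he, rfl⟩)
  | zero => simp
  | add x y _ _ hx hy => rw [map_add]; exact add_mem hx hy
  | smul c x _ hx => rw [map_smul]; exact Submodule.smul_mem _ c hx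

theorem preservesWeight_capEven (n : ℕ) : PreservesWeight (capEven (euler k d) n) :=
  smul _ ((preservesWeight_face n _).comp (preservesWeight_slot _ _))

theorem preservesWeight_capOdd (n : ℕ) : PreservesWeight (capOdd (euler k d) n) :=
  smul _ ((preservesWeight_face n _).comp (preservesWeight_slot _ _))

theorem preservesWeight_cyclicHomotopy (n : ℕ) :
    PreservesWeight (cyclicHomotopy (euler k d) n) :=
  sum _ fun _ => comp (comp (sum _ fun _ => ((preservesWeight_cyclicOp n).pow n).pow _)
    (preservesWeight_slot n _)) ((preservesWeight_cyclicOp n).pow _)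

theorem preservesWeight_vert (p : ℤ) (n : ℕ) : PreservesWeight (vert k (TruncPoly k d) p n) := by
  unfold vert
  split_ifs
  exacts [preservesWeight_hochDiff n, (preservesWeight_barDiff n).neg]

theorem preservesWeight_horiz (p : ℤ) (n : ℕ) :
    PreservesWeight (horiz k (TruncPoly k d) p n) := by
  unfold horiz
  split_ifs
  exacts [preservesWeight_normOp n, one.sub (preservesWeight_cyclicOp n)]

theorem preservesWeight_cap (p : ℤ) (n : ℕ) : PreservesWeight (cap (euler k d) p n) := by
  unfold cap
  split_ifs
  exacts [preservesWeight_capEven n, preservesWeight_capOdd n]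

theorem preservesWeight_rowHomotopy (p : ℤ) (n : ℕ) :
    PreservesWeight (rowHomotopy (euler k d) p n) := by
  unfold rowHomotopy
  split_ifs
  exacts [preservesWeight_cyclicHomotopy n, preservesWeight_slot n _]

theorem preservesWeight_cartanDefect (p : ℤ) (n : ℕ) :
    PreservesWeight (cartanDefect (euler k d) p n) := by
  unfold cartanDefect
  split_ifs
  · exact zero
  · exact add (sub (add ((preservesWeight_normOp n).comp (preservesWeight_capEven n))
      ((preservesWeight_capOdd n).comp (preservesWeight_normOp _)))
      ((preservesWeight_barDiff n).comp (preservesWeight_cyclicHomotopy _)))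
      ((preservesWeight_cyclicHomotopy n).comp (preservesWeight_hochDiff n))

end PreservesWeight

/-! ### Dividing by the weight and removing the defect -/

section WeightOp

variable {d : ℕ}

/-- Two maps that agree on all tensors of pure weight are equal. -/
theorem ext_weightPart {k : Type u} [CommRing k] {M : Type*} [AddCommMonoid M] [Module k M] {n : ℕ}
    {T U : Tens k (TruncPoly k d) n →ₗ[k] M}
    (h : ∀ w, ∀ x ∈ weightPart k d w n, T x = U x) : T = U := by
  rw [← LinearMap.eqLocus_eq_top, eq_top_iff, ← iSup_weightPart, iSup_le_iff]
  exact h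

/-- The operator that multiplies the weight `w` part of the tensor powers by `φ w`. -/
def weightOp (d : ℕ) (φ : ℕ → ℚ) (n : ℕ) : Module.End ℚ (Tens ℚ (TruncPoly ℚ d) n) :=
  Polynomial.aeval (lieOp (euler ℚ d) n)
    (Lagrange.interpolate (Finset.range (n + 2)) (fun w => (w : ℚ)) φ)

/-- The interpolation nodes `0, …, n + 1` include every weight with a nonzero part in this row. -/
theorem weightOp_apply_of_mem (φ : ℕ → ℚ) {w n : ℕ} {x : Tens ℚ (TruncPoly ℚ d) n}
    (hx : x ∈ weightPart ℚ d w n) : weightOp d φ n x = φ w • x := by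
  rcases Nat.lt_or_ge (n + 1) w with h | h
  · rw [weightPart_eq_bot ℚ d h, Submodule.mem_bot] at hx
    rw [hx, map_zero, smul_zero]
  · rw [weightOp, Module.End.aeval_apply_of_mem_apply_eq_smul (μ := (w : ℚ))
      (lieOp_apply_of_mem ℚ d w n x hx),
      Lagrange.eval_interpolate_at_node _ (fun a _ b _ hab => Nat.cast_injective hab)
        (Finset.mem_range.mpr (by omega))]

/-- The interpolating polynomials depend on the row, so commuting with `lieOp` would not suffice.
The comparison is made on tensors of pure weight, where only `φ w` matters. -/
theorem weightOp_comm (φ : ℕ → ℚ) {m n : ℕ}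
    {T : Tens ℚ (TruncPoly ℚ d) m →ₗ[ℚ] Tens ℚ (TruncPoly ℚ d) n} (hT : PreservesWeight T)
    (x : Tens ℚ (TruncPoly ℚ d) m) : T (weightOp d φ m x) = weightOp d φ n (T x) := by
  refine LinearMap.congr_fun (f := T ∘ₗ weightOp d φ m) (g := weightOp d φ n ∘ₗ T)
    (ext_weightPart fun w x hx => ?_) x
  rw [LinearMap.comp_apply, LinearMap.comp_apply, weightOp_apply_of_mem φ hx, map_smul,
    weightOp_apply_of_mem φ (hT w x hx)]

theorem preservesWeight_weightOp (φ : ℕ → ℚ) (n : ℕ) : PreservesWeight (weightOp d φ n) :=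
  fun w x hx => by
    rw [weightOp_apply_of_mem φ hx]
    exact Submodule.smul_mem _ _ hx

/-- The projection of the total complex onto its weight `0` part. -/
def weightZeroProj (d : ℕ) : Total ℚ (TruncPoly ℚ d) →ₗ[ℚ] Total ℚ (TruncPoly ℚ d) :=
  totalMap (weightOp d fun w => if w = 0 then 1 else 0)

/-- Division by the weight on the total complex; it is zero in weight `0`. -/
def weightInv (d : ℕ) : Total ℚ (TruncPoly ℚ d) →ₗ[ℚ] Total ℚ (TruncPoly ℚ d) :=
  totalMap (weightOp d fun w => (w : ℚ)⁻¹)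

theorem lieOp_weightInv (x : Total ℚ (TruncPoly ℚ d)) (q : ℕ) :
    lieOp (euler ℚ d) q (weightInv d x q) = x q - weightZeroProj d x q := by
  refine LinearMap.congr_fun (f := lieOp (euler ℚ d) q ∘ₗ weightOp d (fun w => (w : ℚ)⁻¹) q)
    (g := LinearMap.id - weightOp d (fun w => if w = 0 then 1 else 0) q)
    (ext_weightPart fun w x hx => ?_) (x q)
  rw [LinearMap.comp_apply, LinearMap.sub_apply, weightOp_apply_of_mem _ hx,
    weightOp_apply_of_mem _ hx, map_smul, lieOp_apply_of_mem ℚ d w q x hx, LinearMap.id_apply]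
  by_cases hw : w = 0
  · simp [hw]
  · rw [smul_smul, inv_mul_cancel₀ (Nat.cast_ne_zero.mpr hw), if_neg hw]
    simp

theorem weightZeroProj_weightInv (x : Total ℚ (TruncPoly ℚ d)) :
    weightZeroProj d (weightInv d x) = 0 := by
  funext q
  refine LinearMap.congr_fun (f := weightOp d (fun w => if w = 0 then 1 else 0) q ∘ₗ
    weightOp d (fun w => (w : ℚ)⁻¹) q) (g := 0) (ext_weightPart fun w x hx => ?_) (x q)
  rw [LinearMap.comp_apply, weightOp_apply_of_mem _ hx, map_smul, weightOp_apply_of_mem _ hx]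
  by_cases hw : w = 0
  · simp [hw]
  · simp [hw]

theorem totalD_totalMap_weightOp (φ : ℕ → ℚ) (n : ℤ) (x : Total ℚ (TruncPoly ℚ d)) :
    totalD ℚ _ n (totalMap (weightOp d φ) x) = totalMap (weightOp d φ) (totalD ℚ _ n x) := by
  funext q
  simp only [totalD_apply, totalMap_apply, map_add, weightOp_comm φ (preservesWeight_vert _ _),
    weightOp_comm φ (preservesWeight_horiz _ _)]

theorem totalDefect_totalMap_weightOp (φ : ℕ → ℚ) (n : ℤ) (x : Total ℚ (TruncPoly ℚ d)) :
    totalDefect (euler ℚ d) n (totalMap (weightOp d φ) x) =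
      totalMap (weightOp d φ) (totalDefect (euler ℚ d) n x) := by
  funext q
  simp only [totalDefect_apply, totalMap_apply, weightOp_comm φ (preservesWeight_cartanDefect _ _)]

theorem totalD_totalHomotopy_weightInv (n : ℤ) (x : Total ℚ (TruncPoly ℚ d))
    (hx : totalD ℚ _ (n - 1) x = 0) :
    totalD ℚ _ n (totalHomotopy (euler ℚ d) n (weightInv d x)) =
      x - weightZeroProj d x + totalDefect (euler ℚ d) n (weightInv d x) := by
  funext q
  have h := totalD_totalHomotopy (euler ℚ d) (euler_mul ℚ d) n (weightInv d x) q
  rw [lieOp_weightInv, weightInv, totalD_totalMap_weightOp, hx, map_zero, map_zero, Pi.zero_apply,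
    add_zero] at h
  exact h

/-- It sends a cycle of degree `n` to a primitive of its part of positive weight. -/
def positiveWeightPrimitive (n : ℤ) : Total ℚ (TruncPoly ℚ d) →ₗ[ℚ] Total ℚ (TruncPoly ℚ d) :=
  totalHomotopy (euler ℚ d) n ∘ₗ weightInv d ∘ₗ
    (LinearMap.id - totalDefect (euler ℚ d) n ∘ₗ weightInv d)

/-- Cartan's formula is applied to `x` and then to its own error term. The second error term is
zero, since division by the weight commutes with the defect, whose square is zero. -/
theorem totalD_positiveWeightPrimitive (n : ℤ) (x : Total ℚ (TruncPoly ℚ d))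
    (hx : totalD ℚ _ (n - 1) x = 0) :
    totalD ℚ _ n (positiveWeightPrimitive n x) = x - weightZeroProj d x := by
  have h1 := totalD_totalHomotopy_weightInv n x hx
  -- By the first formula the error term is a boundary minus `x` plus its weight `0` part, all of
  -- them cycles.
  have hz : totalD ℚ _ (n - 1) (totalDefect (euler ℚ d) n (weightInv d x)) = 0 := by
    have h := congrArg (totalD ℚ _ (n - 1)) h1
    have h0 := fun y => LinearMap.congr_fun (totalD_comp_totalD ℚ (TruncPoly ℚ d) (n - 1)) y
    simp only [LinearMap.comp_apply, sub_add_cancel, LinearMap.zero_apply] at h0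
    rw [h0, map_add, map_sub, hx, weightZeroProj, totalD_totalMap_weightOp, hx, map_zero, sub_zero,
      zero_add] at h
    exact h.symm
  have h2 := totalD_totalHomotopy_weightInv n _ hz
  have h3 : weightZeroProj d (totalDefect (euler ℚ d) n (weightInv d x)) = 0 := by
    rw [weightZeroProj, ← totalDefect_totalMap_weightOp]
    exact (congrArg _ (weightZeroProj_weightInv x)).trans (map_zero _)
  have h4 : totalDefect (euler ℚ d) n
      (weightInv d (totalDefect (euler ℚ d) n (weightInv d x))) = 0 := by
    rw [weightInv, totalDefect_totalMap_weightOp, totalDefect_totalMap_weightOp, totalDefect_totalMap_weightOp,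
      totalDefect_totalDefect, map_zero, map_zero]
  rw [h3, h4, sub_zero, add_zero] at h2
  rw [positiveWeightPrimitive, LinearMap.comp_apply, LinearMap.comp_apply, LinearMap.sub_apply,
    LinearMap.id_apply, LinearMap.comp_apply, map_sub, map_sub, map_sub, h1, h2, add_sub_cancel_right]

theorem positiveWeightPrimitive_mem {w : ℕ} (n : ℤ) {x : Total ℚ (TruncPoly ℚ d)}
    (hx : ∀ q, x q ∈ weightPart ℚ d w q) (q : ℕ) :
    positiveWeightPrimitive n x q ∈ weightPart ℚ d w q := by
  have hG : ∀ y : Total ℚ (TruncPoly ℚ d), (∀ q, y q ∈ weightPart ℚ d w q) →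
      ∀ q, weightInv d y q ∈ weightPart ℚ d w q :=
    fun y hy q => preservesWeight_weightOp _ q w _ (hy q)
  have h := hG _ fun q => sub_mem (hx q)
    (preservesWeight_cartanDefect (n - q) q w _ (hG x hx (q + 1)))
  exact add_mem (preservesWeight_cap _ q w _ (h (q + 1))) (preservesWeight_rowHomotopy _ q w _ (h q))

theorem weightZeroProj_mem (x : Total ℚ (TruncPoly ℚ d)) (q : ℕ) :
    weightZeroProj d x q ∈ weightPart ℚ d 0 q := by
  -- Modulo the weight `0` part, membership becomes an equality of linear maps, which can be tested
  -- on pure weights.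
  refine LinearMap.congr_fun (f := (weightPart ℚ d 0 q).mkQ ∘ₗ
    weightOp d (fun w => if w = 0 then 1 else 0) q) (g := 0)
    (ext_weightPart fun w x hx => ?_) (x q) |> (Submodule.Quotient.mk_eq_zero _).mp
  rw [LinearMap.comp_apply, weightOp_apply_of_mem _ hx]
  by_cases hw : w = 0
  · subst hw
    simpa using hx
  · simp [hw]

theorem weightZeroProj_of_mem {w : ℕ} {x : Total ℚ (TruncPoly ℚ d)}
    (hx : ∀ q, x q ∈ weightPart ℚ d w q) : weightZeroProj d x = if w = 0 then x else 0 := by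
  funext q
  rw [weightZeroProj, totalMap_apply, weightOp_apply_of_mem _ (hx q)]
  split_ifs
  · rw [one_smul]
  · rw [zero_smul]; rfl

end WeightOp

/-! ### The weight zero part, spanned by `1 ⊗ ⋯ ⊗ 1` in each row -/

section WeightZero

variable (k A : Type*) [CommRing k] [Ring A] [Algebra k A]

/-- The tensor `1 ⊗ ⋯ ⊗ 1`. -/
def oneTens (q : ℕ) : Tens k A q := PiTensorProduct.tprod k fun _ => 1

theorem face_oneTens (n : ℕ) (i : Fin (n + 2)) :
    face k A n i (oneTens k A (n + 1)) = oneTens k A n := by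
  rw [oneTens, face_tprod]
  congr 1
  funext j
  simp [faceTuple]

/-- All faces agree on this tensor, so only an alternating sum of `n + 2` signs remains;
`barDiff_oneTens` has one sign fewer. -/
theorem hochDiff_oneTens (n : ℕ) :
    hochDiff k A n (oneTens k A (n + 1)) = (if Even n then 0 else 1 : k) • oneTens k A n := by
  simp only [hochDiff, LinearMap.sum_apply, LinearMap.smul_apply, face_oneTens, ← Finset.sum_smul,
    Fin.sum_neg_one_pow]
  simp [Nat.even_add]

theorem barDiff_oneTens (n : ℕ) :
    barDiff k A n (oneTens k A (n + 1)) = (if Even n then 1 else 0 : k) • oneTens k A n := by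
  simp only [barDiff, LinearMap.sum_apply, LinearMap.smul_apply, face_oneTens, ← Finset.sum_smul,
    Fin.sum_neg_one_pow]
  simp only [Nat.even_add_one, ite_not]

theorem cyclicOp_oneTens (n : ℕ) :
    cyclicOp k A n (oneTens k A n) = (-1 : k) ^ n • oneTens k A n := by
  rw [oneTens, cyclicOp, LinearMap.smul_apply, LinearEquiv.coe_coe, PiTensorProduct.reindex_tprod]

theorem normOp_oneTens (n : ℕ) :
    normOp k A n (oneTens k A n) = (if Even n then n + 1 else 0 : k) • oneTens k A n := by
  have h : ∀ i : ℕ, (cyclicOp k A n ^ i) (oneTens k A n) = ((-1 : k) ^ n) ^ i • oneTens k A n := by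
    intro i
    induction i with
    | zero => simp
    | succ i ih =>
      rw [pow_succ', Module.End.mul_apply, ih, map_smul, cyclicOp_oneTens, smul_smul, ← pow_succ]
  simp only [normOp, LinearMap.sum_apply, h, ← Finset.sum_smul]
  by_cases hn : Even n
  · simp [hn]
  · rw [Nat.not_even_iff_odd] at hn
    simp only [hn.neg_one_pow, Finset.sum_range, Fin.sum_neg_one_pow]
    simp [hn]

/-- The family of scalar tensors `c_q • (1 ⊗ ⋯ ⊗ 1)`. -/
def scalarTotal : (ℕ → k) →ₗ[k] Total k A :=
  LinearMap.pi fun q => (LinearMap.toSpanSingleton k _ (oneTens k A q)) ∘ₗ LinearMap.proj q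

theorem scalarTotal_apply (c : ℕ → k) (q : ℕ) : scalarTotal k A c q = c q • oneTens k A q := rfl

/-- The column `n - q` has the parity of `q`. For even `q` both `b` and `1 - t` kill the scalar
tensors, and for odd `q` both `b'` and `N` do. -/
theorem totalD_scalarTotal_even {n : ℤ} (hn : Even n) (c : ℕ → k) :
    totalD k A n (scalarTotal k A c) = 0 := by
  funext q
  rw [totalD_apply, scalarTotal_apply, scalarTotal_apply, map_smul, map_smul, Pi.zero_apply]
  unfold vert horiz
  by_cases hq : Even q
  · have h : Even (n - (q : ℤ)) := hn.sub (by exact_mod_cast hq)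
    rw [if_pos h, if_neg (by simpa [Int.even_add_one] using h), hochDiff_oneTens,
      LinearMap.sub_apply, cyclicOp_oneTens, hq.neg_one_pow]
    simp [hq]
  · have h : ¬ Even (n - (q : ℤ)) := by
      rw [Int.even_sub]
      simp [hn, hq]
    rw [if_neg h, if_pos (by simpa [Int.even_add_one] using h), LinearMap.neg_apply,
      barDiff_oneTens, normOp_oneTens]
    simp [hq]

theorem totalD_scalarTotal_odd {n : ℤ} (hn : Odd n) (c : ℕ → k) :
    totalD k A n (scalarTotal k A c) = scalarTotal k A fun q =>
      if Even q then (q + 1) * c q - c (q + 1) else c (q + 1) + 2 * c q := by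
  rw [← Int.not_even_iff_odd] at hn
  funext q
  rw [totalD_apply, scalarTotal_apply, scalarTotal_apply, map_smul, map_smul, scalarTotal_apply]
  unfold vert horiz
  by_cases hq : Even q
  · have h : ¬ Even (n - (q : ℤ)) := by
      rw [Int.even_sub]
      simp [hn, hq]
    rw [if_neg h, if_pos (by simpa [Int.even_add_one] using h), LinearMap.neg_apply,
      barDiff_oneTens, normOp_oneTens, if_pos hq, if_pos hq, if_pos hq]
    module
  · have h : Even (n - (q : ℤ)) := by
      rw [Int.even_sub]
      simp [hn, hq]
    rw [if_pos h, if_neg (by simpa [Int.even_add_one] using h), hochDiff_oneTens,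
      LinearMap.sub_apply, cyclicOp_oneTens, (Nat.not_even_iff_odd.mp hq).neg_one_pow, if_neg hq,
      if_neg hq, Module.End.one_apply]
    module

end WeightZero

section WeightZeroTrunc

variable (k : Type u) [CommRing k] (d : ℕ)

theorem weightPart_zero (q : ℕ) :
    weightPart k d 0 q = Submodule.span k {oneTens k (TruncPoly k d) q} := by
  rw [weightPart]
  congr 1
  ext x
  simp only [Set.mem_ofPred_eq, Set.mem_singleton_iff]
  constructor
  · rintro ⟨e, he, rfl⟩
    rw [Finset.sum_eq_zero_iff] at he
    rw [oneTens]
    congr 1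
    funext j
    rw [(Finsupp.degree_eq_zero_iff _).mp (he j (Finset.mem_univ j)), mono_zero]
  · rintro rfl
    exact ⟨0, by simp, rfl⟩

theorem mem_range_scalarTotal {x : Total k (TruncPoly k d)} :
    x ∈ Submodule.pi Set.univ (weightPart k d 0) ↔
      ∃ c, scalarTotal k (TruncPoly k d) c = x := by
  constructor
  · intro hx
    have h : ∀ q, ∃ c : k, c • oneTens k (TruncPoly k d) q = x q := fun q => by
      have h : x q ∈ weightPart k d 0 q := hx q trivial
      rwa [weightPart_zero, Submodule.mem_span_singleton] at h
    choose c hc using h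
    exact ⟨c, funext hc⟩
  · rintro ⟨c, rfl⟩ q -
    change c q • oneTens k _ q ∈ weightPart k d 0 q
    rw [weightPart_zero]
    exact Submodule.smul_mem _ _ (Submodule.mem_span_singleton_self _)

/-- The functional on `A^{⊗ (q + 1)}` induced by the augmentation of `A`. -/
def augTens (q : ℕ) : Tens k (TruncPoly k d) q →ₗ[k] k :=
  PiTensorProduct.lift ((MultilinearMap.mkPiAlgebra k (Fin (q + 1)) k).compLinearMap
    fun _ => (augmentation k d).toLinearMap)

theorem augTens_oneTens (q : ℕ) : augTens k d q (oneTens k _ q) = 1 := by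
  simp [augTens, oneTens]

/-- The augmentation of all factors sends `1 ⊗ ⋯ ⊗ 1` to `1` and so recovers each coefficient. -/
theorem scalarTotal_injective : Function.Injective (scalarTotal k (TruncPoly k d)) := by
  intro c c' h
  funext q
  have := congrArg (augTens k d q) (congrFun h q)
  simpa [scalarTotal_apply, augTens_oneTens] using this

theorem exists_totalD_eq_of_odd {n : ℤ} (hn : Odd n) (y : Total k (TruncPoly k d))
    (hy : y ∈ Submodule.pi Set.univ (weightPart k d 0)) :
    ∃ x ∈ Submodule.pi Set.univ (weightPart k d 0), totalD k _ n x = y := by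
  obtain ⟨c, rfl⟩ := (mem_range_scalarTotal k d).mp hy
  -- Each equation is solved for its coefficient of index `q + 1`, which occurs with factor `±1`;
  -- the starting value `0` is arbitrary. The solution may be nonzero in every row, which the direct
  -- product permits.
  let e : ℕ → k := Nat.rec 0 fun q a => if Even q then (q + 1) * a - c q else c q - 2 * a
  refine ⟨scalarTotal k _ e, (mem_range_scalarTotal k d).mpr ⟨_, rfl⟩, ?_⟩
  rw [totalD_scalarTotal_odd k _ hn]
  congr 1
  funext q
  have he : e (q + 1) = if Even q then (q + 1) * e q - c q else c q - 2 * e q := rfl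
  rw [he]
  split_ifs <;> ring

theorem existsUnique_totalD_eq_zero_of_odd {n : ℤ} (hn : Odd n) (a : k) :
    ∃! x : Submodule.pi Set.univ (weightPart k d 0),
      totalD k _ n x.1 = 0 ∧ augTens k d 0 (x.1 0) = a := by
  -- The homogeneous recursion: the entry `a` in row `0` forces all others.
  let e : ℕ → k := Nat.rec a fun q b => if Even q then (q + 1) * b else - 2 * b
  have he : ∀ q, e (q + 1) = if Even q then (q + 1) * e q else - 2 * e q := fun q => rfl
  refine ⟨⟨scalarTotal k _ e, (mem_range_scalarTotal k d).mpr ⟨_, rfl⟩⟩, ⟨?_, ?_⟩, ?_⟩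
  · rw [totalD_scalarTotal_odd k _ hn, ← map_zero (scalarTotal k _)]
    congr 1
    funext q
    rw [he, Pi.zero_apply]
    split_ifs <;> ring
  · change augTens k d 0 (e 0 • oneTens k _ 0) = a
    rw [map_smul, augTens_oneTens]
    exact mul_one a
  · rintro ⟨x, hx⟩ ⟨h1, h2⟩
    obtain ⟨c, rfl⟩ := (mem_range_scalarTotal k d).mp hx
    refine Subtype.ext (congrArg (scalarTotal k _) (funext fun q => ?_))
    simp only [totalD_scalarTotal_odd k _ hn] at h1
    have h1' := fun q => congrFun (scalarTotal_injective k d (h1.trans (map_zero _).symm)) q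
    simp only [Pi.zero_apply] at h1'
    induction q with
    | zero =>
      change augTens k d 0 (c 0 • oneTens k _ 0) = a at h2
      rw [map_smul, augTens_oneTens] at h2
      exact (mul_one _).symm.trans h2
    | succ q ih =>
      have h := h1' q
      rw [he, ← ih]
      split_ifs at h ⊢
      · linear_combination -h
      · linear_combination h

end WeightZeroTrunc

/-! ### Passage to homology -/

section Homology

open CategoryTheory

variable {d : ℕ}

theorem weightComplex_d (k : Type u) [CommRing k] (w : ℕ) (n : ℤ) :
    (weightComplex k d w).d (n + 1) n =
      ModuleCat.ofHom ((totalD k _ n).restrict ((isStable_weightPart k d w).totalD_mem n)) := by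
  simp only [weightComplex, periodicSubcomplex, ChainComplex.of_d]

theorem periodicComplex_d (k A : Type u) [CommRing k] [Ring A] [Algebra k A] (n : ℤ) :
    (periodicComplex k A).d (n + 1) n = ModuleCat.ofHom (totalD k A n) := by
  simp only [periodicComplex, ChainComplex.of_d]

theorem isZero_HPWeight {k : Type u} [CommRing k] {w : ℕ} {n : ℤ}
    (h : ∀ x ∈ Submodule.pi Set.univ (weightPart k d w), totalD k _ n x = 0 →
      ∃ y ∈ Submodule.pi Set.univ (weightPart k d w), totalD k _ (n + 1) y = x) :
    Limits.IsZero (HPWeight k d w (n + 1)) := by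
  rw [← HomologicalComplex.exactAt_iff_isZero_homology,
    HomologicalComplex.exactAt_iff' _ (n + 1 + 1) (n + 1) n (by simp) (by simp),
    ShortComplex.moduleCat_exact_iff]
  intro x hx
  change (weightComplex k d w).d (n + 1) n x = 0 at hx
  change ∃ y, (weightComplex k d w).d (n + 1 + 1) (n + 1) y = x
  rw [weightComplex_d] at hx ⊢
  obtain ⟨y, hy, hyx⟩ := h x.1 x.2 (congrArg Subtype.val hx)
  exact ⟨⟨y, hy⟩, Subtype.ext hyx⟩

theorem isZero_HPWeight_of_pos {w : ℕ} (hw : 0 < w) (n : ℤ) :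
    Limits.IsZero (HPWeight ℚ d w (n + 1)) := by
  refine isZero_HPWeight fun x hx h => ?_
  have hx' : ∀ q, x q ∈ weightPart ℚ d w q := fun q => hx q trivial
  refine ⟨positiveWeightPrimitive (n + 1) x,
    fun q _ => positiveWeightPrimitive_mem (n + 1) hx' q, ?_⟩
  rw [totalD_positiveWeightPrimitive (n + 1) x (by rwa [add_sub_cancel_right]),
    weightZeroProj_of_mem hx', if_neg hw.ne', sub_zero]

theorem isZero_HPWeight_zero_of_even {k : Type u} [CommRing k] {n : ℤ} (hn : Even n) :
    Limits.IsZero (HPWeight k d 0 (n + 1)) :=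
  isZero_HPWeight fun x hx _ => exists_totalD_eq_of_odd k d hn.add_one x hx

/-- The functional on the weight `0` part of the total complex given by the augmentation of the
component in `A`. -/
def weightZeroFunctional (k : Type u) [CommRing k] (d : ℕ) :
    (Submodule.pi Set.univ (weightPart k d 0) : Submodule k (Total k (TruncPoly k d))) →ₗ[k] k :=
  augTens k d 0 ∘ₗ LinearMap.proj 0 ∘ₗ Submodule.subtype _

/-- The weight `0` cycles of even degree. -/
def weightZeroCyclesEquiv (k : Type u) [CommRing k] (d : ℕ) {n : ℤ} (hn : Odd n) :
    LinearMap.ker ((weightComplex k d 0).d (n + 1) n).hom ≃ₗ[k] k :=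
  LinearEquiv.ofBijective
    ((weightZeroFunctional k d) ∘ₗ
      (LinearMap.ker ((weightComplex k d 0).d (n + 1) n).hom).subtype) <| by
    have hker : ∀ x, x ∈ LinearMap.ker ((weightComplex k d 0).d (n + 1) n).hom ↔
        totalD k _ n x.1 = 0 := fun x => by
      rw [weightComplex_d]
      exact Subtype.ext_iff
    refine Function.bijective_iff_existsUnique _ |>.mpr fun a => ?_
    obtain ⟨x, ⟨hx, hxa⟩, hu⟩ := existsUnique_totalD_eq_zero_of_odd k d hn a
    exact ⟨⟨x, (hker x).mpr hx⟩, hxa, fun y hy =>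
      Subtype.ext (hu y.1 ⟨(hker y.1).mp y.2, hy⟩)⟩

/-- The weight `0` part of periodic cyclic homology in even degrees. -/
def weightZeroHomologyIso (k : Type u) [CommRing k] (d : ℕ) {n : ℤ} (hn : Odd n) :
    HPWeight k d 0 (n + 1) ≅ ModuleCat.of k k :=
  ((weightComplex k d 0).isoHomologyπ (n + 1 + 1) (n + 1) (by simp) (by
    -- The incoming differential is zero in even degree, so homology is the space of cycles.
    rw [weightComplex_d]
    refine ModuleCat.hom_ext (LinearMap.ext fun x => Subtype.ext ?_)
    obtain ⟨c, hc⟩ := (mem_range_scalarTotal k d).mp x.2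
    change totalD k _ (n + 1) x.1 = 0
    rw [← hc]
    exact totalD_scalarTotal_even k _ hn.add_one c)).symm ≪≫
  (weightComplex k d 0).cyclesIsoSc' (n + 1 + 1) (n + 1) n (by simp) (by simp) ≪≫
  ShortComplex.moduleCatCyclesIso _ ≪≫ (weightZeroCyclesEquiv k d hn).toModuleIso

/-- The projection onto the weight `0` subcomplex. -/
def weightZeroRetraction (d : ℕ) : Total ℚ (TruncPoly ℚ d) →ₗ[ℚ]
    (Submodule.pi Set.univ (weightPart ℚ d 0) : Submodule ℚ (Total ℚ (TruncPoly ℚ d))) :=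
  (weightZeroProj d).codRestrict _ fun x q _ => weightZeroProj_mem x q

theorem isIso_homologyMap_weightInclusion (n : ℤ) :
    IsIso (HomologicalComplex.homologyMap (weightInclusion ℚ d 0) (n + 1)) := by
  have hmono : Mono (HomologicalComplex.homologyMap (weightInclusion ℚ d 0) (n + 1)) := by
    rw [HomologicalComplex.mono_homologyMap_iff_up_to_refinements _ (n + 1 + 1) (n + 1) n
      (by simp) (by simp)]
    intro B x _ y hxy
    -- The projection to weight `0` is a chain map that fixes `x`, so it turns a primitive `y` of
    -- `x` into one of weight `0`.
    refine ⟨B, 𝟙 B, inferInstance, y ≫ ModuleCat.ofHom (weightZeroRetraction d), ?_⟩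
    rw [periodicComplex_d] at hxy
    rw [weightComplex_d, Category.id_comp]
    refine ModuleCat.hom_ext (LinearMap.ext fun b => Subtype.ext ?_)
    have h : (x.hom b).1 = totalD ℚ _ (n + 1) (y.hom b) := congrArg (fun f => f.hom b) hxy
    have hx := weightZeroProj_of_mem (w := 0) fun q => (x.hom b).2 q trivial
    change (x.hom b).1 = totalD ℚ _ (n + 1) (weightZeroProj d (y.hom b))
    exact hx.symm.trans ((congrArg (weightZeroProj d) h).trans
      (totalD_totalMap_weightOp _ (n + 1) _).symm)
  have hepi : Epi (HomologicalComplex.homologyMap (weightInclusion ℚ d 0) (n + 1)) := by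
    rw [HomologicalComplex.epi_homologyMap_iff_up_to_refinements _ (n + 1 + 1) (n + 1) n
      (by simp) (by simp)]
    intro B y hy
    rw [periodicComplex_d] at hy
    have hy' : ∀ b, totalD ℚ _ n (y.hom b) = 0 := fun b => congrArg (fun f => f.hom b) hy
    -- A cycle is its weight `0` part plus the boundary of `positiveWeightPrimitive`.
    refine ⟨B, 𝟙 B, inferInstance, y ≫ ModuleCat.ofHom (weightZeroRetraction d), ?_,
      y ≫ ModuleCat.ofHom (positiveWeightPrimitive (n + 1)), ?_⟩
    · rw [weightComplex_d]
      refine ModuleCat.hom_ext (LinearMap.ext fun b => Subtype.ext ?_)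
      exact (totalD_totalMap_weightOp _ n _).trans
        ((congrArg (weightZeroProj d) (hy' b)).trans (map_zero _))
    · rw [periodicComplex_d, Category.id_comp]
      refine ModuleCat.hom_ext (LinearMap.ext fun b => ?_)
      have h := totalD_positiveWeightPrimitive (n + 1) (y.hom b)
        (by rw [add_sub_cancel_right]; exact hy' b)
      exact (sub_eq_iff_eq_add'.mp h.symm)
  exact isIso_of_mono_of_epi _

end Homology

end
end CyclicHomology

theorem mainTheorem9 (d : ℕ) :
    (∀ n : ℤ, Even n →
      Nonempty (CategoryTheory.Iso (CyclicHomology.HPWeight ℚ d 0 n) (ModuleCat.of ℚ ℚ))) ∧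
    (∀ n : ℤ, Odd n → CategoryTheory.Limits.IsZero (CyclicHomology.HPWeight ℚ d 0 n)) ∧
    (∀ w : ℕ, 0 < w → ∀ n : ℤ,
      CategoryTheory.Limits.IsZero (CyclicHomology.HPWeight ℚ d w n)) ∧
    (∀ n : ℤ, CategoryTheory.IsIso
      (HomologicalComplex.homologyMap (CyclicHomology.weightInclusion ℚ d 0) n)) := by
  refine ⟨fun n hn => ?_, fun n hn => ?_, fun w hw n => ?_, fun n => ?_⟩ <;>
    -- Differentials are indexed by their target, so the one leaving degree `m + 1` is `totalD` at
    -- `m`.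
    obtain ⟨n, rfl⟩ : ∃ m, n = m + 1 := ⟨n - 1, (sub_add_cancel n 1).symm⟩
  · exact ⟨CyclicHomology.weightZeroHomologyIso ℚ d
      (by rwa [Int.even_add_one, Int.not_even_iff_odd] at hn)⟩
  · exact CyclicHomology.isZero_HPWeight_zero_of_even
      (by rwa [← Int.not_even_iff_odd, Int.even_add_one, not_not] at hn)
  · exact CyclicHomology.isZero_HPWeight_of_pos hw n
  · exact CyclicHomology.isIso_homologyMap_weightInclusion n
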